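/- Let $M^n$ be a smooth manifold of dimension $n$ (without boundary) and let $g,\bar g$ be Riemannian metrics of class $C^2$ on $M^n$ which are geodesically equivalent, i.e. which have the same geodesics considered as unparametrized curves: every geodesic of $g$ (for the Levi-Civita connection of $g$, defined on an open interval) becomes a geodesic of $\bar g$ after a regular change of parameter, and vice versa. Let $G:TM^n\to TM^n$ be the fibrewise linear map with $g(G\xi,\nu)=\bar g(\xi,\nu)$, i.e. $G=(g^{i\alpha}\bar g_{\alpha j})$, let $c_0,\dots,c_n$ be the functions on $M^n$ defined by $\det(G-\mu E)=c_0\mu^n+c_1\mu^{n-1}+\dots+c_n$, where $E$ is the identity, and for $k=0,\dots,n-1$ put $$S_k=\left(\frac{\det g}{\det\bar g}\right)^{\frac{k+2}{n+1}}\sum_{i=0}^{k}c_i\,G^{k-i+1},\qquad I_k:T^*M^n\to\mathbb R,\quad I_k(x,p)=g(S_k\xi,\xi),$$ where $\xi\in T_xM^n$ is the vector corresponding to $p\in T_x^*M^n$ under the identification given by $g$, i.e. $g(\xi,\cdot)=p$. Let $H(x,p)=\tfrac12 g(\xi,\xi)$ be the Hamiltonian of the geodesic flow of $g$ on $T^*M^n$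 with its standard symplectic form. Then the functions $I_0,\dots,I_{n-1}$ are of class $C^2$ on $T^*M^n$, are quadratic forms in $p$ on each cotangent space, and pairwise Poisson-commute: $\{I_k,I_l\}=0$ for all $0\le k,l\le n-1$. Moreover, if $n\ge1$, then $I_{n-1}=-2H$. Consequently, $\{I_k,H\}=0$ and each $I_k$ is constant along every solution (defined on an open interval) of the Hamiltonian system of $H$; that is, the $I_k$ are quadratic integrals in involution of the geodesic flow of $g$. -/

import Mathlib

open Set Bundle Filter
open scoped Manifold ContDiff Topology Matrix

noncomputable section

namespace GeodEquiv

/-- The model space `ℝⁿ`. -/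
abbrev E (n : ℕ) : Type := EuclideanSpace ℝ (Fin n)

/-- The standard basis vector `e_i` of `ℝⁿ`. -/
def stdVec {n : ℕ} (i : Fin n) : E n := EuclideanSpace.single i (1 : ℝ)

section Manifold

variable {n : ℕ} {M : Type*} [TopologicalSpace M] [ChartedSpace (E n) M]

variable (n M) in
/-- A Riemannian metric of class `C²` on the manifold `M` modelled on `ℝⁿ`. -/
abbrev Metric [IsManifold 𝓘(ℝ, E n) ∞ M] : Type _ :=
  ContMDiffRiemannianMetric (B := M) 𝓘(ℝ, E n) 2 (E n)
    (fun x : M => TangentSpace 𝓘(ℝ, E n) x)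

variable (n M) in
/-- The smooth charts of `M`. -/
abbrev charts : Set (OpenPartialHomeomorph M (E n)) :=
  IsManifold.maximalAtlas 𝓘(ℝ, E n) ∞ M

/-! ### Geodesics -/

/-- The coordinate vector field `∂/∂q^i` of the chart `e`, at the point with coordinates `q`. -/
def coordVec (e : OpenPartialHomeomorph M (E n)) (q : E n) (i : Fin n) :
    TangentSpace 𝓘(ℝ, E n) (e.symm q) :=
  mfderiv 𝓘(ℝ, E n) 𝓘(ℝ, E n) e.symm q (stdVec i)

variable [IsManifold 𝓘(ℝ, E n) ∞ M]

/-- The matrix `(g_{ij}(q))` of the metric in the chart `e`. -/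
def chartMatrix (g : Metric n M) (e : OpenPartialHomeomorph M (E n)) (q : E n) :
    Matrix (Fin n) (Fin n) ℝ :=
  Matrix.of fun i j => g.inner (e.symm q) (coordVec e q i) (coordVec e q j)

/-- The partial derivative `∂g_{ij}/∂q^l` in the chart `e`. -/
def dChartMatrix (g : Metric n M) (e : OpenPartialHomeomorph M (E n)) (q : E n)
    (l i j : Fin n) : ℝ :=
  fderiv ℝ (fun q' => chartMatrix g e q' i j) q (stdVec l)

/-- The Christoffel symbol `Γ^k_{ij}` of the Levi-Civita connection in the chart `e`. -/
def christoffel (g : Metric n M) (e : OpenPartialHomeomorph M (E n)) (q : E n)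
    (k i j : Fin n) : ℝ :=
  (1 / 2) * ∑ l, (chartMatrix g e q)⁻¹ k l *
    (dChartMatrix g e q i j l + dChartMatrix g e q j i l - dChartMatrix g e q l i j)

/-- `γ` restricted to the open set `J` is an (affinely parametrized) geodesic of `g`: in every
smooth chart, `c'' ^ k + Γ^k_{ij} c' ^ i c' ^ j = 0` for the coordinate expression `c` of `γ`. -/
def IsGeodesicOn (g : Metric n M) (γ : ℝ → M) (J : Set ℝ) : Prop :=
  ContinuousOn γ J ∧
  ∀ t ∈ J, ∀ e ∈ charts n M, γ t ∈ e.source →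
    DifferentiableAt ℝ (fun s => e (γ s)) t ∧
    ∀ k, HasDerivAt (fun s => deriv (fun r => e (γ r)) s k)
      (-∑ i, ∑ j, christoffel g e (e (γ t)) k i j *
        deriv (fun r => e (γ r)) t i * deriv (fun r => e (γ r)) t j) t

/-- An open interval of the real line, possibly unbounded. -/
def IsOpenInterval (J : Set ℝ) : Prop := IsOpen J ∧ J.OrdConnected

/-- `φ` is a regular change of parameter from the open interval `J'` onto `J`. -/
def IsReparam (φ : ℝ → ℝ) (J' J : Set ℝ) : Prop :=
  IsOpenInterval J' ∧ ContDiffOn ℝ 2 φ J' ∧ (∀ s ∈ J', deriv φ s ≠ 0) ∧ BijOn φ J' J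

/-- Every geodesic of `g` becomes a geodesic of `g'` after a change of parameter. -/
def GeodesicsInclude (g g' : Metric n M) : Prop :=
  ∀ (J : Set ℝ) (γ : ℝ → M), IsOpenInterval J → IsGeodesicOn g γ J →
    ∃ (J' : Set ℝ) (φ : ℝ → ℝ), IsReparam φ J' J ∧ IsGeodesicOn g' (γ ∘ φ) J'

/-- Geodesic equivalence: the two metrics have the same unparametrized geodesics. -/
def GeodesicallyEquivalent (g g' : Metric n M) : Prop :=
  GeodesicsInclude g g' ∧ GeodesicsInclude g' g

/-! ### The endomorphisms `G` and `S_k` of the tangent bundle -/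

/-- A basis of `T_xM` (the coordinate basis of the preferred chart at `x`). The objects defined
with it below do not depend on the choice of the basis. -/
def tangentBasis (x : M) : Module.Basis (Fin n) ℝ (TangentSpace 𝓘(ℝ, E n) x) :=
  (EuclideanSpace.basisFun (Fin n) ℝ).toBasis

/-- The matrix `(g_{ij})` of the metric at `x`. -/
def gram (g : Metric n M) (x : M) : Matrix (Fin n) (Fin n) ℝ :=
  Matrix.of fun i j => g.inner x (tangentBasis x i) (tangentBasis x j)

/-- The fibrewise linear map `G` with matrix `(g^{iα} ḡ_{αj})`. -/
def opG (g g' : Metric n M) (x : M) :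
    TangentSpace 𝓘(ℝ, E n) x →ₗ[ℝ] TangentSpace 𝓘(ℝ, E n) x :=
  Matrix.toLin (tangentBasis x) (tangentBasis x) ((gram g x)⁻¹ * gram g' x)

/-- The polynomial `det (G - μ E)` in the indeterminate `μ`. -/
def charPolyG (g g' : Metric n M) (x : M) : Polynomial ℝ :=
  Matrix.det ((LinearMap.toMatrix (tangentBasis x) (tangentBasis x) (opG g g' x)).map Polynomial.C
    - (Polynomial.X : Polynomial ℝ) • (1 : Matrix (Fin n) (Fin n) (Polynomial ℝ)))

/-- The coefficient `c_i` in `det (G - μ E) = c_0 μ ^ n + c_1 μ ^ (n - 1) + ⋯ + c_n`. -/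
def charCoeff (g g' : Metric n M) (x : M) (i : ℕ) : ℝ := (charPolyG g g' x).coeff (n - i)

/-- `S_k = (det g / det ḡ) ^ ((k + 2) / (n + 1)) • ∑_{i = 0}^k c_i G ^ (k - i + 1)`. -/
def opS (g g' : Metric n M) (k : ℕ) (x : M) :
    TangentSpace 𝓘(ℝ, E n) x →ₗ[ℝ] TangentSpace 𝓘(ℝ, E n) x :=
  (((gram g x).det / (gram g' x).det) ^ (((k : ℝ) + 2) / ((n : ℝ) + 1)) : ℝ) •
    ∑ i ∈ Finset.range (k + 1), charCoeff g g' x i • opG g g' x ^ (k - i + 1)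

/-! ### Functions on the cotangent bundle -/

variable (n M) in
/-- The cotangent bundle `T*M`. -/
abbrev Cotangent : Type _ :=
  TotalSpace (E n →L[ℝ] ℝ) (fun x : M => TangentSpace 𝓘(ℝ, E n) x →L[ℝ] ℝ)

/-- The identification `T*_xM ≅ T_xM` given by `g`: `ξ^i = g^{ij} p_j`. -/
def sharp (g : Metric n M) (x : M) (p : TangentSpace 𝓘(ℝ, E n) x →L[ℝ] ℝ) :
    TangentSpace 𝓘(ℝ, E n) x :=
  ∑ i, ((gram g x)⁻¹ *ᵥ fun j => p (tangentBasis x j)) i • tangentBasis x i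

/-- The Hamiltonian `H = g(ξ, ξ) / 2` of the geodesic flow. -/
def hamiltonian (g : Metric n M) (z : Cotangent n M) : ℝ :=
  (1 / 2) * g.inner z.1 (sharp g z.1 z.2) (sharp g z.1 z.2)

/-- The function `I_k(x, ξ) = g(S_k ξ, ξ)` on `T*M`. -/
def integralI (g g' : Metric n M) (k : ℕ) (z : Cotangent n M) : ℝ :=
  g.inner z.1 (opS g g' k z.1 (sharp g z.1 z.2)) (sharp g z.1 z.2)

end Manifold

section Symplectic

variable {n : ℕ} {M : Type*} [TopologicalSpace M] [ChartedSpace (E n) M]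

/-- The covector with canonical coordinates `(q, p)` induced by the chart `e`: it is
`∑ p_i dq^i` at the point with coordinates `q`. -/
def ofCanonical (e : OpenPartialHomeomorph M (E n)) (w : E n × E n) : Cotangent n M :=
  ⟨e.symm w.1, (innerSL ℝ w.2 : E n →L[ℝ] ℝ).comp
    (mfderiv 𝓘(ℝ, E n) 𝓘(ℝ, E n) e (e.symm w.1))⟩

/-- The canonical coordinates `(q, p)`, `p_i = z(∂/∂q^i)`, of the covector `z`. -/
def toCanonical (e : OpenPartialHomeomorph M (E n)) (z : Cotangent n M) : E n × E n :=
  (e z.1, WithLp.toLp 2 fun i =>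
    z.2 (mfderiv 𝓘(ℝ, E n) 𝓘(ℝ, E n) e.symm (e z.1) (stdVec i)))

/-- The coordinate expression of a function on `T*M`. -/
def inCoords (e : OpenPartialHomeomorph M (E n)) (F : Cotangent n M → ℝ) (w : E n × E n) : ℝ :=
  F (ofCanonical e w)

/-- `∂F/∂q^i` in canonical coordinates. -/
def dq (F : E n × E n → ℝ) (w : E n × E n) (i : Fin n) : ℝ := fderiv ℝ F w (stdVec i, 0)

/-- `∂F/∂p_i` in canonical coordinates. -/
def dp (F : E n × E n → ℝ) (w : E n × E n) (i : Fin n) : ℝ := fderiv ℝ F w (0, stdVec i)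

/-- The Poisson bracket of the standard symplectic form, in the canonical coordinates induced by
the chart `e`. -/
def poissonBracket (e : OpenPartialHomeomorph M (E n)) (F K : Cotangent n M → ℝ)
    (w : E n × E n) : ℝ :=
  ∑ i, (dq (inCoords e F) w i * dp (inCoords e K) w i
    - dp (inCoords e F) w i * dq (inCoords e K) w i)

/-- `F` is of class `C²` on `T*M`: it is so in all canonical coordinates. -/
def IsC2 (F : Cotangent n M → ℝ) : Prop :=
  ∀ e ∈ charts n M, ContDiffOn ℝ 2 (inCoords e F) (e.target ×ˢ univ)

/-- The Poisson bracket of `F` and `K` vanishes at all points of `T*M`. -/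
def PoissonCommute (F K : Cotangent n M → ℝ) : Prop :=
  ∀ e ∈ charts n M, ∀ q ∈ e.target, ∀ p : E n, poissonBracket e F K (q, p) = 0

/-- `z` restricted to `J` is a solution of the Hamiltonian system on `T*M` with Hamiltonian `F`. -/
def IsHamiltonianOrbit (F : Cotangent n M → ℝ) (z : ℝ → Cotangent n M) (J : Set ℝ) : Prop :=
  ContinuousOn (fun t => (z t).1) J ∧
  ∀ t ∈ J, ∀ e ∈ charts n M, (z t).1 ∈ e.source → ∀ i,
    HasDerivAt (fun s => (toCanonical e (z s)).1 i)
      (dp (inCoords e F) (toCanonical e (z t)) i) t ∧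
    HasDerivAt (fun s => (toCanonical e (z s)).2 i)
      (-dq (inCoords e F) (toCanonical e (z t)) i) t

end Symplectic

end GeodEquiv

end

/-!
The proof works in an arbitrary chart, where everything reduces to identities between the Gram
matrices `a`, `b` of `g`, `ḡ` and their first derivatives at a single point.

Put `ρ = (det a / det b) ^ (1 / (n + 1))` and let `L = ρ⁻¹ G⁻¹ = σ a`, `σ = ρ⁻¹ b⁻¹`, be the Benenti
tensor. A telescoping sum and the Cayley–Hamilton theorem show that `∑ S_k t ^ (n - 1 - k)` is minus
the adjugate of `1 - t L` (`one_sub_mul_sum`, `sum_matIntegral`). So each `I_k` is, near a given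
point, a combination with constant coefficients of the functions
`F_t = det (1 - t L) ⟨(1 - t L)⁻¹ ξ, ξ⟩` at `n` distinct nodes `t` (`exists_nodes`); this gives
the regularity, and `t = 0` gives `I_{n-1} = -2H`. It remains to prove `{F_t, F_s} = 0`.

Geodesics through every point in every direction exist by Picard–Lindelöf (`exists_geodesic`; the
transformation law `chrisVec_transition` of the Christoffel symbols makes a solution in one chart a
solution in all). Comparing accelerations, `Γ̄(u, u) - Γ(u, u)` is proportional to `u` for all `u`,
whence Weyl's relation `Γ̄^k_{ij} = Γ^k_{ij} + δ^k_i φ_j + δ^k_j φ_i` (`exists_christoffel_eq`).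
Together with Jacobi's formula for the derivative of `ρ` it yields the Benenti equation
`∇_X σ = X ⊗ Λ + Λ ⊗ X` with `Λ = -σ φ` (`hasDerivAt_sigma`), and from it the derivative of `F_t`
(`hasDerivAt_genFun`). In the Poisson bracket the Christoffel symbols cancel by symmetry, and the
remaining terms cancel by the resolvent identity for the pencil `N_t = a⁻¹ - t σ`
(`sum_bracket_eq_zero`).
-/

namespace GeodEquiv

/-! ### The integrals as functions of a pair of Gram matrices -/

section Algebra

variable {n : ℕ}

/-- The polynomial `det (G - μ E)` of a matrix `G`. -/
noncomputable def detSubX (G : Matrix (Fin n) (Fin n) ℝ) : Polynomial ℝ :=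
  Matrix.det (G.map Polynomial.C
    - (Polynomial.X : Polynomial ℝ) • (1 : Matrix (Fin n) (Fin n) (Polynomial ℝ)))

/-- The matrix of the endomorphism `S_k` built from the Gram matrices `a` of `g` and `b` of `ḡ`
in a common basis. -/
noncomputable def matS (k : ℕ) (a b : Matrix (Fin n) (Fin n) ℝ) : Matrix (Fin n) (Fin n) ℝ :=
  ((a.det / b.det) ^ (((k : ℝ) + 2) / ((n : ℝ) + 1)) : ℝ) •
    ∑ i ∈ Finset.range (k + 1), (detSubX (a⁻¹ * b)).coeff (n - i) • (a⁻¹ * b) ^ (k - i + 1)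

/-- The value of `I_k` at the covector with components `p`, in terms of Gram matrices. -/
noncomputable def matIntegral (k : ℕ) (a b : Matrix (Fin n) (Fin n) ℝ) (p : Fin n → ℝ) : ℝ :=
  (matS k a b *ᵥ (a⁻¹ *ᵥ p)) ⬝ᵥ p

theorem detSubX_eq (G : Matrix (Fin n) (Fin n) ℝ) :
    detSubX G = (-1) ^ n * G.charpoly := by
  have : G.map Polynomial.C
      - (Polynomial.X : Polynomial ℝ) • (1 : Matrix (Fin n) (Fin n) (Polynomial ℝ))
      = -G.charmatrix := by
    ext i j : 2
    simp [Matrix.charmatrix_apply, Matrix.one_apply, Matrix.diagonal_apply]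
  rw [detSubX, this, Matrix.det_neg, Matrix.charpoly, Fintype.card_fin]

theorem natDegree_detSubX_lt (G : Matrix (Fin n) (Fin n) ℝ) :
    (detSubX G).natDegree < n + 1 := by
  rw [detSubX_eq, ← map_one (Polynomial.C), ← map_neg, ← map_pow]
  refine lt_of_le_of_lt (Polynomial.natDegree_C_mul_le _ _) ?_
  rw [Matrix.charpoly_natDegree_eq_dim, Fintype.card_fin]; omega

theorem sum_coeff_detSubX_smul_pow (G : Matrix (Fin n) (Fin n) ℝ) :
    ∑ i ∈ Finset.range (n + 1), (detSubX G).coeff (n - i) • G ^ (n - i) = 0 := by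
  have h : Polynomial.aeval G (detSubX G) = 0 := by
    rw [detSubX_eq, map_mul, Matrix.aeval_self_charpoly, mul_zero]
  rw [Polynomial.aeval_eq_sum_range' (natDegree_detSubX_lt G)] at h
  rw [← h, ← Finset.sum_range_reflect]
  refine Finset.sum_congr rfl fun i hi => ?_
  rw [Finset.mem_range] at hi
  simp only [Nat.add_sub_cancel]
  rw [Nat.sub_sub_self (by omega)]

theorem sum_coeff_detSubX_mul_pow (G : Matrix (Fin n) (Fin n) ℝ) (μ : ℝ) :
    ∑ i ∈ Finset.range (n + 1), (detSubX G).coeff (n - i) * μ ^ (n - i)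
      = (G - μ • (1 : Matrix (Fin n) (Fin n) ℝ)).det := by
  have h : (detSubX G).eval μ = (G - μ • (1 : Matrix (Fin n) (Fin n) ℝ)).det := by
    rw [detSubX, ← Polynomial.coe_evalRingHom, RingHom.map_det]
    congr 1
    ext i j
    simp [Matrix.one_apply]
    split_ifs <;> simp
  rw [Polynomial.eval_eq_sum_range' (natDegree_detSubX_lt G)] at h
  rw [← h, ← Finset.sum_range_reflect]
  refine Finset.sum_congr rfl fun i hi => ?_
  rw [Finset.mem_range] at hi
  simp only [Nat.add_sub_cancel]
  rw [Nat.sub_sub_self (by omega)]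

/-- The generating polynomial of the `S_k` is, up to sign, the adjugate of `1 - t L`, where
`L = ρ⁻¹ G⁻¹`. The product telescopes, and the last term vanishes by the Cayley–Hamilton
theorem. -/
theorem one_sub_mul_sum (G : Matrix (Fin n) (Fin n) ℝ) {r : ℝ} (hr : r ≠ 0)
    (hG : G.det * r ^ (n + 1) = 1) (t : ℝ) :
    (1 - (t * r⁻¹) • G⁻¹) * ∑ k ∈ Finset.range n, t ^ (n - 1 - k) • (r ^ (k + 2) •
        ∑ i ∈ Finset.range (k + 1), (detSubX G).coeff (n - i) • G ^ (k - i + 1))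
      = -(1 - (t * r⁻¹) • G⁻¹).det • (1 : Matrix (Fin n) (Fin n) ℝ) := by
  have hGu : IsUnit G.det := (left_ne_zero_of_mul_eq_one hG).isUnit
  set c : ℕ → ℝ := fun i => (detSubX G).coeff (n - i) with hc
  set T : ℕ → Matrix (Fin n) (Fin n) ℝ := fun k =>
    ∑ i ∈ Finset.range (k + 1), c i • G ^ (k - i) with hT
  have hTG : ∀ k, ∑ i ∈ Finset.range (k + 1), c i • G ^ (k - i + 1) = G * T k := by
    intro k
    rw [hT, Finset.mul_sum]
    exact Finset.sum_congr rfl fun i _ => by rw [mul_smul_comm, pow_succ']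
  have hTs : ∀ k, G * T k = T (k + 1) - c (k + 1) • (1 : Matrix (Fin n) (Fin n) ℝ) := by
    intro k
    rw [← hTG]
    simp only [hT]
    rw [Finset.sum_range_succ _ (k + 1)]
    simp only [Nat.sub_self, pow_zero, add_sub_cancel_right]
    refine Finset.sum_congr rfl fun i hi => ?_
    rw [Finset.mem_range] at hi
    rw [show k + 1 - i = k - i + 1 by omega]
  have hTn : T n = 0 := sum_coeff_detSubX_smul_pow G
  have key : ∀ k ∈ Finset.range n, (1 - (t * r⁻¹) • G⁻¹) * (t ^ (n - 1 - k) • (r ^ (k + 2) •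
        ∑ i ∈ Finset.range (k + 1), (detSubX G).coeff (n - i) • G ^ (k - i + 1)))
      = ((r ^ (k + 1 + 1) * t ^ (n - (k + 1))) • T (k + 1) - (r ^ (k + 1) * t ^ (n - k)) • T k)
        - (r ^ (k + 1 + 1) * t ^ (n - (k + 1)) * c (k + 1)) •
          (1 : Matrix (Fin n) (Fin n) ℝ) := by
    intro k hk
    rw [Finset.mem_range] at hk
    have h1 : t ^ (n - k) = t * t ^ (n - (k + 1)) := by
      rw [← pow_succ']; congr 1; omega
    have h2 : n - 1 - k = n - (k + 1) := by omega
    rw [hTG, h2, sub_mul, one_mul, smul_smul, mul_smul_comm, smul_mul_assoc,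
      Matrix.nonsing_inv_mul_cancel_left _ _ hGu, hTs, smul_smul, h1, smul_sub, smul_smul]
    have h3 : t ^ (n - (k + 1)) * r ^ (k + 2) * (t * r⁻¹)
        = r ^ (k + 1) * (t * t ^ (n - (k + 1))) := by
      field_simp
      ring
    rw [h3, show t ^ (n - (k + 1)) * r ^ (k + 2) = r ^ (k + 1 + 1) * t ^ (n - (k + 1)) by ring]
    abel
  rw [Finset.mul_sum, Finset.sum_congr rfl key, Finset.sum_sub_distrib,
    Finset.sum_range_sub (fun k => (r ^ (k + 1) * t ^ (n - k)) • T k), hTn, smul_zero, zero_sub]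
  -- what is left is the expansion of `-r ^ (n + 1) * det (G - (t / r) E)` in powers of `t`
  have hT0 : T 0 = c 0 • (1 : Matrix (Fin n) (Fin n) ℝ) := by simp [hT]
  rw [hT0, smul_smul, ← Finset.sum_smul, ← neg_smul, ← sub_smul]
  congr 1
  have hdet : (1 - (t * r⁻¹) • G⁻¹).det
      = r ^ (n + 1) * (G - (t * r⁻¹) • (1 : Matrix (Fin n) (Fin n) ℝ)).det := by
    have : G - (t * r⁻¹) • (1 : Matrix (Fin n) (Fin n) ℝ) = G * (1 - (t * r⁻¹) • G⁻¹) := by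
      rw [mul_sub, mul_one, mul_smul_comm, Matrix.mul_nonsing_inv _ hGu]
    rw [this, Matrix.det_mul, ← mul_assoc, mul_comm (r ^ (n + 1)), hG, one_mul]
  rw [hdet, ← sum_coeff_detSubX_mul_pow, Finset.mul_sum, Finset.sum_range_succ', neg_add,
    sub_eq_add_neg, add_comm]
  congr 1
  · congr 1
    refine Finset.sum_congr rfl fun k hk => ?_
    rw [Finset.mem_range] at hk
    obtain ⟨m, rfl⟩ : ∃ m, n = m + (k + 1) := ⟨n - (k + 1), by omega⟩
    rw [Nat.add_sub_cancel, mul_pow, inv_pow]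
    simp only [hc, Nat.add_sub_cancel]
    field_simp
    ring
  · simp only [Nat.sub_zero, hc, mul_pow, inv_pow, zero_add, pow_one]
    field_simp
    ring

/-- The density factor `ρ = (det g / det ḡ) ^ (1 / (n + 1))`. -/
noncomputable def rho (a b : Matrix (Fin n) (Fin n) ℝ) : ℝ :=
  (a.det / b.det) ^ (1 / ((n : ℝ) + 1))

/-- The contravariant symmetric matrix `σ = ρ⁻¹ ḡ⁻¹`, which is the Benenti tensor `L = σ g` with
one index raised by `g`. -/
noncomputable def sigma (a b : Matrix (Fin n) (Fin n) ℝ) : Matrix (Fin n) (Fin n) ℝ :=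
  (rho a b)⁻¹ • b⁻¹

/-- The pencil `N_t = g⁻¹ - t σ` of contravariant symmetric matrices. -/
noncomputable def pencil (a b : Matrix (Fin n) (Fin n) ℝ) (t : ℝ) : Matrix (Fin n) (Fin n) ℝ :=
  a⁻¹ - t • sigma a b

/-- The generating function `F_t(p) = det (1 - t L) ⟨p, g⁻¹ N_t⁻¹ g⁻¹ p⟩` of the integrals. -/
noncomputable def genFun (a b : Matrix (Fin n) (Fin n) ℝ) (t : ℝ) (p : Fin n → ℝ) : ℝ :=
  (pencil a b t).det * a.det *
    ((a⁻¹ *ᵥ ((pencil a b t)⁻¹ *ᵥ (a⁻¹ *ᵥ p))) ⬝ᵥ p)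

theorem rho_pos {a b : Matrix (Fin n) (Fin n) ℝ} (ha : 0 < a.det) (hb : 0 < b.det) :
    0 < rho a b := Real.rpow_pos_of_pos (div_pos ha hb) _

theorem rho_pow {a b : Matrix (Fin n) (Fin n) ℝ} (ha : 0 < a.det) (hb : 0 < b.det) :
    rho a b ^ (n + 1) = a.det / b.det := by
  rw [rho, ← Real.rpow_natCast, ← Real.rpow_mul (div_pos ha hb).le]
  have : (n : ℝ) + 1 ≠ 0 := by positivity
  push_cast
  rw [one_div, inv_mul_cancel₀ this, Real.rpow_one]

theorem det_ratio_rpow {a b : Matrix (Fin n) (Fin n) ℝ} (ha : 0 < a.det) (hb : 0 < b.det)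
    (k : ℕ) : (a.det / b.det) ^ (((k : ℝ) + 2) / ((n : ℝ) + 1)) = rho a b ^ (k + 2) := by
  rw [rho, ← Real.rpow_natCast (_ ^ _), ← Real.rpow_mul (div_pos ha hb).le]
  congr 1
  push_cast
  ring

/-- The polynomial in `t` with coefficients the `I_k` is, up to sign, the generating function. -/
theorem sum_matIntegral {a b : Matrix (Fin n) (Fin n) ℝ} (ha : 0 < a.det) (hb : 0 < b.det)
    (p : Fin n → ℝ) {t : ℝ} (ht : (pencil a b t).det ≠ 0) :
    ∑ k ∈ Finset.range n, matIntegral k a b p * t ^ (n - 1 - k) = -genFun a b t p := by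
  have hau : IsUnit a.det := ha.ne'.isUnit
  have hbu : IsUnit b.det := hb.ne'.isUnit
  have hr := rho_pos ha hb
  set r := rho a b with hrdef
  have hGdet : (a⁻¹ * b).det * r ^ (n + 1) = 1 := by
    rw [rho_pow ha hb, Matrix.det_mul, Matrix.det_nonsing_inv, Ring.inverse_eq_inv']
    field_simp
  have key := one_sub_mul_sum (a⁻¹ * b) hr.ne' hGdet t
  have hN : 1 - (t * r⁻¹) • (a⁻¹ * b)⁻¹ = pencil a b t * a := by
    rw [Matrix.mul_inv_rev, Matrix.nonsing_inv_nonsing_inv _ hau, pencil, sigma, sub_mul,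
      Matrix.nonsing_inv_mul _ hau, smul_smul, smul_mul_assoc]
  rw [hN] at key
  set B := ∑ k ∈ Finset.range n, t ^ (n - 1 - k) • (r ^ (k + 2) •
        ∑ i ∈ Finset.range (k + 1), (detSubX (a⁻¹ * b)).coeff (n - i) • (a⁻¹ * b) ^ (k - i + 1))
    with hB
  have hB1 : B = -(pencil a b t * a).det • (a⁻¹ * (pencil a b t)⁻¹) := by
    have := congrArg (fun Z => a⁻¹ * ((pencil a b t)⁻¹ * Z)) key
    rw [mul_assoc (pencil a b t) a B, Matrix.nonsing_inv_mul_cancel_left _ _ ht.isUnit,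
      Matrix.nonsing_inv_mul_cancel_left _ _ hau, mul_smul_comm, mul_one, mul_smul_comm] at this
    exact this
  have hB2 : ∑ k ∈ Finset.range n, matIntegral k a b p * t ^ (n - 1 - k)
      = (B *ᵥ (a⁻¹ *ᵥ p)) ⬝ᵥ p := by
    rw [hB, Matrix.sum_mulVec, sum_dotProduct]
    refine Finset.sum_congr rfl fun k _ => ?_
    rw [Matrix.smul_mulVec, smul_dotProduct, matIntegral, matS, det_ratio_rpow ha hb,
      smul_eq_mul, mul_comm]
  rw [hB2, hB1, genFun, Matrix.det_mul, Matrix.smul_mulVec, smul_dotProduct,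
    ← Matrix.mulVec_mulVec, smul_eq_mul, neg_mul]

theorem pencil_zero (a b : Matrix (Fin n) (Fin n) ℝ) : pencil a b 0 = a⁻¹ := by
  simp [pencil]

theorem matIntegral_last {a b : Matrix (Fin n) (Fin n) ℝ} (ha : 0 < a.det) (hb : 0 < b.det)
    (p : Fin n → ℝ) {k : ℕ} (hk : k + 1 = n) :
    matIntegral k a b p = -((a⁻¹ *ᵥ p) ⬝ᵥ p) := by
  have h0 : (pencil a b 0).det ≠ 0 := by
    rw [pencil_zero, Matrix.det_nonsing_inv, Ring.inverse_eq_inv']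
    exact inv_ne_zero ha.ne'
  have h := sum_matIntegral ha hb p h0
  rw [Finset.sum_eq_single k] at h
  · rw [show n - 1 - k = 0 by omega, pow_zero, mul_one] at h
    rw [h, genFun, pencil_zero, Matrix.det_nonsing_inv, Ring.inverse_eq_inv',
      inv_mul_cancel₀ ha.ne', one_mul, Matrix.nonsing_inv_nonsing_inv _ ha.ne'.isUnit,
      Matrix.mulVec_mulVec _ a, Matrix.mul_nonsing_inv _ ha.ne'.isUnit, Matrix.one_mulVec]
  · intro j hj hjk
    rw [Finset.mem_range] at hj
    rw [zero_pow (by omega), mul_zero]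
  · intro h; exact absurd (Finset.mem_range.2 (by omega)) h

/-- `I_k` as a combination of values of the generating function at `n` distinct nodes. -/
theorem matIntegral_eq_sum_genFun {a b : Matrix (Fin n) (Fin n) ℝ} (ha : 0 < a.det)
    (hb : 0 < b.det) (p : Fin n → ℝ) {v : Fin n → ℝ} (hv : Function.Injective v)
    (ht : ∀ j, (pencil a b (v j)).det ≠ 0) {k : ℕ} (hk : k < n) :
    matIntegral k a b p = ∑ j, -(Lagrange.basis Finset.univ v j).coeff (n - 1 - k)
      * genFun a b (v j) p := by
  set P : Polynomial ℝ := ∑ k ∈ Finset.range n,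
    Polynomial.C (matIntegral k a b p) * Polynomial.X ^ (n - 1 - k) with hP
  have hdeg : P.degree < (Finset.univ : Finset (Fin n)).card := by
    rw [Finset.card_univ, Fintype.card_fin]
    refine lt_of_le_of_lt (Polynomial.degree_sum_le _ _) ?_
    rw [Finset.sup_lt_iff (by exact_mod_cast WithBot.bot_lt_coe n)]
    intro i hi
    rw [Finset.mem_range] at hi
    refine lt_of_le_of_lt (Polynomial.degree_C_mul_X_pow_le _ _) ?_
    exact_mod_cast (by omega : n - 1 - i < n)
  have hint := Lagrange.eq_interpolate hv.injOn hdeg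
  have hc : P.coeff (n - 1 - k) = matIntegral k a b p := by
    rw [hP, Polynomial.finsetSum_coeff, Finset.sum_eq_single k]
    · simp
    · intro j hj hjk
      rw [Finset.mem_range] at hj
      rw [Polynomial.coeff_C_mul_X_pow, if_neg (by omega)]
    · intro h; exact absurd (Finset.mem_range.2 hk) h
  rw [← hc, hint, Lagrange.interpolate_apply, Polynomial.finsetSum_coeff]
  refine Finset.sum_congr rfl fun j _ => ?_
  rw [Polynomial.coeff_C_mul]
  have : Polynomial.eval (v j) P = -genFun a b (v j) p := by
    rw [← sum_matIntegral ha hb p (ht j), hP, Polynomial.eval_finsetSum]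
    simp
  rw [this]
  ring

/-- `I_k` does not depend on the basis in which the Gram matrices are taken. -/
theorem matIntegral_conj (k : ℕ) (a b J : Matrix (Fin n) (Fin n) ℝ)
    (hJ : IsUnit J.det) (p : Fin n → ℝ) :
    matIntegral k (Jᵀ * a * J) (Jᵀ * b * J) (Jᵀ *ᵥ p) = matIntegral k a b p := by
  have hJt : IsUnit Jᵀ.det := by rwa [Matrix.det_transpose]
  have hinv : (Jᵀ * a * J)⁻¹ = J⁻¹ * a⁻¹ * (Jᵀ)⁻¹ := by
    rw [Matrix.mul_inv_rev, Matrix.mul_inv_rev, mul_assoc]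
  have hG : (Jᵀ * a * J)⁻¹ * (Jᵀ * b * J) = J⁻¹ * (a⁻¹ * b) * J := by
    rw [hinv]
    simp only [mul_assoc]
    rw [Matrix.nonsing_inv_mul_cancel_left _ _ hJt]
  have hpow : ∀ m, (J⁻¹ * (a⁻¹ * b) * J) ^ m = J⁻¹ * (a⁻¹ * b) ^ m * J := by
    intro m
    induction m with
    | zero => rw [pow_zero, pow_zero, mul_one, Matrix.nonsing_inv_mul _ hJ]
    | succ m ih =>
      rw [pow_succ, ih, pow_succ]
      simp only [mul_assoc]
      rw [Matrix.mul_nonsing_inv_cancel_left _ _ hJ]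
  have hchar : detSubX (J⁻¹ * (a⁻¹ * b) * J) = detSubX (a⁻¹ * b) := by
    rw [detSubX_eq, detSubX_eq]
    congr 1
    exact Matrix.charpoly_units_conj' (J.nonsingInvUnit hJ) (a⁻¹ * b)
  have hdet : (Jᵀ * a * J).det / (Jᵀ * b * J).det = a.det / b.det := by
    simp only [Matrix.det_mul, Matrix.det_transpose]
    have := hJ.ne_zero
    field_simp
  have hS : matS k (Jᵀ * a * J) (Jᵀ * b * J) = J⁻¹ * matS k a b * J := by
    simp only [matS]
    rw [hG, hchar, hdet, mul_smul_comm, smul_mul_assoc, Finset.mul_sum, Finset.sum_mul]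
    congr 1
    refine Finset.sum_congr rfl fun i _ => ?_
    rw [hpow, mul_smul_comm, smul_mul_assoc]
  rw [matIntegral, matIntegral, hS, hinv, Matrix.mulVec_mulVec, Matrix.mulVec_mulVec,
    Matrix.mulVec_mulVec, Matrix.dotProduct_mulVec, ← Matrix.mulVec_transpose,
    Matrix.transpose_transpose, Matrix.mulVec_mulVec]
  congr 2
  simp only [mul_assoc]
  rw [Matrix.nonsing_inv_mul _ hJt, mul_one, Matrix.mul_nonsing_inv_cancel_left _ _ hJ,
    Matrix.mul_nonsing_inv_cancel_left _ _ hJ]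

end Algebra

/-! ### Calculus of matrix-valued functions -/

section MatrixCalculus

open scoped Matrix.Norms.Operator

variable {n : ℕ} {F : Type*} [NormedAddCommGroup F] [NormedSpace ℝ F]

theorem hasDerivAt_matrix_of_entries {A : ℝ → Matrix (Fin n) (Fin n) ℝ}
    {A' : Matrix (Fin n) (Fin n) ℝ} {x : ℝ}
    (h : ∀ i j, HasDerivAt (fun s => A s i j) (A' i j) x) : HasDerivAt A A' x := by
  have h1 : HasDerivAt (fun s => ∑ i, ∑ j, A s i j • Matrix.single i j (1 : ℝ))
      (∑ i, ∑ j, A' i j • Matrix.single i j (1 : ℝ)) x :=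
    HasDerivAt.fun_sum fun i _ => HasDerivAt.fun_sum fun j _ => (h i j).smul_const _
  have h2 : ∀ B : Matrix (Fin n) (Fin n) ℝ,
      ∑ i, ∑ j, B i j • Matrix.single i j (1 : ℝ) = B := by
    intro B
    conv_rhs => rw [Matrix.matrix_eq_sum_single B]
    simp
  simpa only [h2] using h1

theorem contDiffAt_matrix_of_entries {A : F → Matrix (Fin n) (Fin n) ℝ} {m : WithTop ℕ∞} {x : F}
    (h : ∀ i j, ContDiffAt ℝ m (fun s => A s i j) x) : ContDiffAt ℝ m A x := by
  have h1 : ContDiffAt ℝ m (fun s => ∑ i, ∑ j, A s i j • Matrix.single i j (1 : ℝ)) x :=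
    ContDiffAt.sum fun i _ => ContDiffAt.sum fun j _ => (h i j).smul contDiffAt_const
  have h2 : ∀ B : Matrix (Fin n) (Fin n) ℝ,
      ∑ i, ∑ j, B i j • Matrix.single i j (1 : ℝ) = B := by
    intro B
    conv_rhs => rw [Matrix.matrix_eq_sum_single B]
    simp
  simpa only [h2] using h1

/-- The entry `A ↦ A i j` as a continuous linear map. -/
noncomputable def entryCLM (i j : Fin n) : Matrix (Fin n) (Fin n) ℝ →L[ℝ] ℝ :=
  LinearMap.toContinuousLinearMap (Matrix.entryLinearMap ℝ ℝ i j)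

theorem hasDerivAt_entry {A : ℝ → Matrix (Fin n) (Fin n) ℝ}
    {A' : Matrix (Fin n) (Fin n) ℝ} {x : ℝ} (h : HasDerivAt A A' x) (i j : Fin n) :
    HasDerivAt (fun s => A s i j) (A' i j) x :=
  (entryCLM i j).hasFDerivAt.comp_hasDerivAt x h

theorem contDiffAt_entry {A : F → Matrix (Fin n) (Fin n) ℝ} {m : WithTop ℕ∞} {x : F}
    (h : ContDiffAt ℝ m A x) (i j : Fin n) : ContDiffAt ℝ m (fun s => A s i j) x :=
  (entryCLM i j).contDiff.contDiffAt.comp x h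

/-- Jacobi's formula for the derivative of a determinant. -/
theorem hasDerivAt_det {A : ℝ → Matrix (Fin n) (Fin n) ℝ}
    {A' : Matrix (Fin n) (Fin n) ℝ} {x : ℝ} (h : HasDerivAt A A' x) :
    HasDerivAt (fun s => (A s).det) ((A x).adjugate * A').trace x := by
  have h1 : HasDerivAt (fun s => (A s).det) (∑ σ : Equiv.Perm (Fin n),
      ((Equiv.Perm.sign σ : ℤ) : ℝ) * ∑ i, (∏ j ∈ Finset.univ.erase i, A x (σ j) j)
        • A' (σ i) i) x := by
    simp only [Matrix.det_apply']
    exact HasDerivAt.fun_sum fun σ _ => (HasDerivAt.fun_finsetProd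
      fun i _ => hasDerivAt_entry h (σ i) i).const_mul _
  convert h1 using 1
  have h2 : ((A x).adjugate * A').trace = ∑ i, ((A x).updateCol i (fun k => A' k i)).det := by
    rw [Matrix.trace]
    refine Finset.sum_congr rfl fun i _ => ?_
    rw [← Matrix.cramer_apply, Matrix.cramer_eq_adjugate_mulVec]
    rfl
  rw [h2]
  simp only [Matrix.det_apply', Finset.mul_sum]
  rw [Finset.sum_comm]
  refine Finset.sum_congr rfl fun σ _ => Finset.sum_congr rfl fun i _ => ?_
  rw [← Finset.prod_erase_mul _ _ (Finset.mem_univ i), Matrix.updateCol_self, smul_eq_mul]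
  congr 2
  refine Finset.prod_congr rfl fun j hj => ?_
  rw [Matrix.updateCol_ne (Finset.ne_of_mem_erase hj)]

theorem hasDerivAt_det_of_isUnit {A : ℝ → Matrix (Fin n) (Fin n) ℝ}
    {A' : Matrix (Fin n) (Fin n) ℝ} {x : ℝ} (h : HasDerivAt A A' x) (hx : (A x).det ≠ 0) :
    HasDerivAt (fun s => (A s).det) ((A x).det * ((A x)⁻¹ * A').trace) x := by
  convert hasDerivAt_det h using 1
  rw [Matrix.inv_def, Ring.inverse_eq_inv', Matrix.smul_mul, Matrix.trace_smul, smul_eq_mul,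
    mul_inv_cancel_left₀ hx]

theorem hasDerivAt_matrix_inv {A : ℝ → Matrix (Fin n) (Fin n) ℝ}
    {A' : Matrix (Fin n) (Fin n) ℝ} {x : ℝ} (h : HasDerivAt A A' x) (hx : (A x).det ≠ 0) :
    HasDerivAt (fun s => (A s)⁻¹) (-((A x)⁻¹ * A' * (A x)⁻¹)) x := by
  have hu : IsUnit (A x) := (Matrix.isUnit_iff_isUnit_det _).2 hx.isUnit
  obtain ⟨u, hu⟩ := hu
  have h1 := hasFDerivAt_ringInverse (𝕜 := ℝ) u
  rw [hu] at h1
  have h2 := h1.comp_hasDerivAt x h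
  simp only [Matrix.nonsing_inv_eq_ringInverse]
  refine h2.congr_deriv ?_
  rw [← hu, Ring.inverse_unit]
  simp

theorem contDiff_det : ContDiff ℝ ω (fun A : Matrix (Fin n) (Fin n) ℝ => A.det) := by
  simp only [Matrix.det_apply']
  refine ContDiff.sum fun σ _ => contDiff_const.mul (contDiff_prod fun i _ => ?_)
  exact (entryCLM (σ i) i).contDiff

theorem contDiffAt_matrix_det {A : F → Matrix (Fin n) (Fin n) ℝ} {m : WithTop ℕ∞} {x : F}
    (h : ContDiffAt ℝ m A x) : ContDiffAt ℝ m (fun s => (A s).det) x :=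
  (contDiff_det.of_le le_top).contDiffAt.comp x h

theorem contDiffAt_matrix_inv {A : F → Matrix (Fin n) (Fin n) ℝ} {m : WithTop ℕ∞} {x : F}
    (h : ContDiffAt ℝ m A x) (hx : (A x).det ≠ 0) : ContDiffAt ℝ m (fun s => (A s)⁻¹) x := by
  have hu : IsUnit (A x) := (Matrix.isUnit_iff_isUnit_det _).2 hx.isUnit
  obtain ⟨u, hu⟩ := hu
  have h1 := contDiffAt_ringInverse ℝ (n := m) u
  rw [hu] at h1
  simp only [Matrix.nonsing_inv_eq_ringInverse]
  exact h1.comp x h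

/-! ### Smoothness of the generating function -/

section Smooth

variable {a b : F → Matrix (Fin n) (Fin n) ℝ} {m : WithTop ℕ∞} {x : F}

theorem contDiffAt_pencil (ha : ContDiffAt ℝ m a x) (hb : ContDiffAt ℝ m b x)
    (ha0 : 0 < (a x).det) (hb0 : 0 < (b x).det) (t : ℝ) :
    ContDiffAt ℝ m (fun y => pencil (a y) (b y) t) x := by
  have h1 : ContDiffAt ℝ m (fun y => rho (a y) (b y)) x := by
    unfold rho
    refine ContDiffAt.rpow_const_of_ne ?_ (div_pos ha0 hb0).ne'
    exact (contDiffAt_matrix_det ha).div (contDiffAt_matrix_det hb) hb0.ne'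
  unfold pencil sigma
  have h2 : ContDiffAt ℝ m (fun y => (rho (a y) (b y))⁻¹ • (b y)⁻¹) x :=
    (h1.inv (rho_pos ha0 hb0).ne').smul (contDiffAt_matrix_inv hb hb0.ne')
  exact (contDiffAt_matrix_inv ha ha0.ne').sub (h2.const_smul t)

theorem contDiffAt_genFun (ha : ContDiffAt ℝ m a x) (hb : ContDiffAt ℝ m b x)
    (ha0 : 0 < (a x).det) (hb0 : 0 < (b x).det) {t : ℝ} (ht : (pencil (a x) (b x) t).det ≠ 0)
    {p : F → Fin n → ℝ} (hp : ∀ i, ContDiffAt ℝ m (fun y => p y i) x) :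
    ContDiffAt ℝ m (fun y => genFun (a y) (b y) t (p y)) x := by
  have hN := contDiffAt_pencil ha hb ha0 hb0 t
  have hK := ((contDiffAt_matrix_inv ha ha0.ne').mul (contDiffAt_matrix_inv hN ht)).mul
    (contDiffAt_matrix_inv ha ha0.ne')
  unfold genFun
  refine ((contDiffAt_matrix_det hN).mul (contDiffAt_matrix_det ha)).mul ?_
  have : ∀ y, ((a y)⁻¹ *ᵥ ((pencil (a y) (b y) t)⁻¹ *ᵥ ((a y)⁻¹ *ᵥ p y))) ⬝ᵥ p y
      = ∑ i, (∑ j, ((a y)⁻¹ * (pencil (a y) (b y) t)⁻¹ * (a y)⁻¹) i j * p y j) * p y i := by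
    intro y
    rw [Matrix.mulVec_mulVec, Matrix.mulVec_mulVec]
    rfl
  simp only [this]
  exact ContDiffAt.sum fun i _ => (ContDiffAt.sum fun j _ =>
    (contDiffAt_entry hK i j).mul (hp j)).mul (hp i)

end Smooth

/-! ### Variation of the generating function along a coordinate line -/

section Variation

variable {a b : ℝ → Matrix (Fin n) (Fin n) ℝ} {Γ : Matrix (Fin n) (Fin n) ℝ} {φ X : Fin n → ℝ}

theorem hasDerivAt_inv_metric (ha : HasDerivAt a (a 0 * Γ + Γᵀ * a 0) 0)
    (ha0 : (a 0).det ≠ 0) :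
    HasDerivAt (fun s => (a s)⁻¹) (-(Γ * (a 0)⁻¹) - (a 0)⁻¹ * Γᵀ) 0 := by
  convert hasDerivAt_matrix_inv ha ha0 using 1
  rw [mul_add, add_mul, Matrix.nonsing_inv_mul_cancel_left _ _ ha0.isUnit]
  simp only [mul_assoc]
  rw [Matrix.mul_nonsing_inv _ ha0.isUnit, mul_one]
  abel

theorem hasDerivAt_det_metric (ha : HasDerivAt a (a 0 * Γ + Γᵀ * a 0) 0)
    (ha0 : (a 0).det ≠ 0) :
    HasDerivAt (fun s => (a s).det) ((a 0).det * (2 * Γ.trace)) 0 := by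
  convert hasDerivAt_det_of_isUnit ha ha0 using 2
  rw [mul_add, Matrix.nonsing_inv_mul_cancel_left _ _ ha0.isUnit, Matrix.trace_add,
    ← mul_assoc, Matrix.trace_mul_comm, ← mul_assoc, Matrix.mul_nonsing_inv _ ha0.isUnit,
    one_mul, Matrix.trace_transpose]
  ring

/-- The matrix `Γ + φ(X) 1 + X ⊗ φ`: if `Γ` is the connection matrix of `g` in direction `X`, this
is the one of a metric with the same unparametrized geodesics. -/
noncomputable def projChange (Γ : Matrix (Fin n) (Fin n) ℝ) (φ X : Fin n → ℝ) :
    Matrix (Fin n) (Fin n) ℝ :=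
  Γ + (φ ⬝ᵥ X) • (1 : Matrix (Fin n) (Fin n) ℝ) + Matrix.vecMulVec X φ

theorem hasDerivAt_rho (ha : HasDerivAt a (a 0 * Γ + Γᵀ * a 0) 0)
    (hb : HasDerivAt b (b 0 * projChange Γ φ X + (projChange Γ φ X)ᵀ * b 0) 0)
    (ha0 : 0 < (a 0).det) (hb0 : 0 < (b 0).det) :
    HasDerivAt (fun s => rho (a s) (b s)) (-2 * (φ ⬝ᵥ X) * rho (a 0) (b 0)) 0 := by
  have h1 := hasDerivAt_det_metric ha ha0.ne'
  have h2 := hasDerivAt_det_metric hb hb0.ne'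
  have hq : 0 < (a 0).det / (b 0).det := div_pos ha0 hb0
  have h3 := (h1.fun_div h2 hb0.ne').rpow_const (p := 1 / ((n : ℝ) + 1)) (Or.inl hq.ne')
  unfold rho
  convert h3 using 1
  have htr : (projChange Γ φ X).trace = Γ.trace + (n + 1) * (φ ⬝ᵥ X) := by
    rw [projChange, Matrix.trace_add, Matrix.trace_add, Matrix.trace_vecMulVec,
      Matrix.trace_smul, Matrix.trace_one, Fintype.card_fin, dotProduct_comm X, smul_eq_mul]
    ring
  rw [htr, Real.rpow_sub_one hq.ne']
  have hn : (n : ℝ) + 1 ≠ 0 := by positivity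
  have := ha0.ne'
  have := hb0.ne'
  field_simp
  ring

theorem transpose_sigma (A B : Matrix (Fin n) (Fin n) ℝ) (hB : Bᵀ = B) :
    (sigma A B)ᵀ = sigma A B := by
  rw [sigma, Matrix.transpose_smul, Matrix.transpose_nonsing_inv, hB]

theorem transpose_pencil (A B : Matrix (Fin n) (Fin n) ℝ) (hA : Aᵀ = A) (hB : Bᵀ = B) (t : ℝ) :
    (pencil A B t)ᵀ = pencil A B t := by
  rw [pencil, Matrix.transpose_sub, Matrix.transpose_smul, transpose_sigma A B hB,
    Matrix.transpose_nonsing_inv, hA]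

/-- The Benenti (Sinjukov) equation: the covariant derivative of `σ` in direction `X` is
`X ⊗ Λ + Λ ⊗ X`, where `Λ = -σ φ`. -/
theorem hasDerivAt_sigma (ha : HasDerivAt a (a 0 * Γ + Γᵀ * a 0) 0)
    (hb : HasDerivAt b (b 0 * projChange Γ φ X + (projChange Γ φ X)ᵀ * b 0) 0)
    (ha0 : 0 < (a 0).det) (hb0 : 0 < (b 0).det) (hsb : (b 0)ᵀ = b 0) :
    HasDerivAt (fun s => sigma (a s) (b s))
      (-(Γ * sigma (a 0) (b 0)) - sigma (a 0) (b 0) * Γᵀ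
        + Matrix.vecMulVec X (-(sigma (a 0) (b 0) *ᵥ φ))
        + Matrix.vecMulVec (-(sigma (a 0) (b 0) *ᵥ φ)) X) 0 := by
  have hr := rho_pos ha0 hb0
  have h1 := (hasDerivAt_rho ha hb ha0 hb0).fun_inv hr.ne'
  have h2 := h1.smul (hasDerivAt_inv_metric hb hb0.ne')
  unfold sigma at *
  refine h2.congr_deriv ?_
  have e1 : -(-2 * (φ ⬝ᵥ X) * rho (a 0) (b 0)) / rho (a 0) (b 0) ^ 2
      = 2 * (φ ⬝ᵥ X) * (rho (a 0) (b 0))⁻¹ := by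
    field_simp
  rw [e1]
  have e2 : φ ᵥ* (b 0)⁻¹ = (b 0)⁻¹ *ᵥ φ := by
    rw [← Matrix.mulVec_transpose, Matrix.transpose_nonsing_inv, hsb]
  simp only [projChange, Matrix.transpose_add, Matrix.transpose_smul, Matrix.transpose_one,
    Matrix.transpose_vecMulVec, add_mul, mul_add, smul_mul_assoc, mul_smul_comm, one_mul, mul_one,
    Matrix.vecMulVec_mul, Matrix.mul_vecMulVec, e2, Matrix.smul_mulVec, Matrix.vecMulVec_neg,
    Matrix.neg_vecMulVec, Matrix.vecMulVec_smul, Matrix.smul_vecMulVec]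
  module

theorem hasDerivAt_pencil (ha : HasDerivAt a (a 0 * Γ + Γᵀ * a 0) 0)
    (hb : HasDerivAt b (b 0 * projChange Γ φ X + (projChange Γ φ X)ᵀ * b 0) 0)
    (ha0 : 0 < (a 0).det) (hb0 : 0 < (b 0).det) (hsb : (b 0)ᵀ = b 0) (t : ℝ) :
    HasDerivAt (fun s => pencil (a s) (b s) t)
      (-(Γ * pencil (a 0) (b 0) t) - pencil (a 0) (b 0) t * Γᵀ
        - t • (Matrix.vecMulVec X (-(sigma (a 0) (b 0) *ᵥ φ))
          + Matrix.vecMulVec (-(sigma (a 0) (b 0) *ᵥ φ)) X)) 0 := by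
  have h := (hasDerivAt_inv_metric ha ha0.ne').sub
    ((hasDerivAt_sigma ha hb ha0 hb0 hsb).const_smul t)
  unfold pencil
  refine h.congr_deriv ?_
  simp only [mul_sub, sub_mul, mul_smul_comm, smul_mul_assoc]
  module

/-- The derivative of the generating function in direction `X`: the part with `Γ` is the change
of the momentum by parallel transport, the rest is the covariant derivative. -/
theorem hasDerivAt_genFun (ha : HasDerivAt a (a 0 * Γ + Γᵀ * a 0) 0)
    (hb : HasDerivAt b (b 0 * projChange Γ φ X + (projChange Γ φ X)ᵀ * b 0) 0)
    (ha0 : 0 < (a 0).det) (hb0 : 0 < (b 0).det) (hsa : (a 0)ᵀ = a 0) (hsb : (b 0)ᵀ = b 0)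
    {t : ℝ} (ht : (pencil (a 0) (b 0) t).det ≠ 0) (p : Fin n → ℝ)
    {D : ℝ} (hD : D = (pencil (a 0) (b 0) t).det * (a 0).det)
    {Λ v u : Fin n → ℝ} (hΛ : Λ = -(sigma (a 0) (b 0) *ᵥ φ))
    (hv : v = (pencil (a 0) (b 0) t)⁻¹ *ᵥ ((a 0)⁻¹ *ᵥ p)) (hu : u = (a 0)⁻¹ *ᵥ v) :
    HasDerivAt (fun s => genFun (a s) (b s) t p)
      (D * (2 * t * ((v ⬝ᵥ X) * (Λ ⬝ᵥ v)
        - (((pencil (a 0) (b 0) t)⁻¹ *ᵥ Λ) ⬝ᵥ X) * (u ⬝ᵥ p)))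
        - 2 * D * ((Γ *ᵥ u) ⬝ᵥ p)) 0 := by
  have hN := hasDerivAt_pencil ha hb ha0 hb0 hsb t
  rw [← hΛ] at hN
  set N := pencil (a 0) (b 0) t with hNdef
  set h := (a 0)⁻¹ with hh
  have hNu : IsUnit N.det := ht.isUnit
  have hNs : (N⁻¹)ᵀ = N⁻¹ := by
    rw [Matrix.transpose_nonsing_inv, transpose_pencil _ _ hsa hsb]
  have hhs : hᵀ = h := by rw [hh, Matrix.transpose_nonsing_inv, hsa]
  have dN := hasDerivAt_det_of_isUnit hN ht
  have dD := dN.mul (hasDerivAt_det_metric ha ha0.ne')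
  have dNi := hasDerivAt_matrix_inv hN ht
  have dh := hasDerivAt_inv_metric ha ha0.ne'
  have dK := (dh.mul dNi).mul dh
  have dotK : ∀ (A : Matrix (Fin n) (Fin n) ℝ), ∑ i, (∑ j, A i j * p j) * p i = (A *ᵥ p) ⬝ᵥ p :=
    fun A => rfl
  have dQ := HasDerivAt.fun_sum (u := Finset.univ) fun i _ =>
    (HasDerivAt.fun_sum (u := Finset.univ) fun j _ =>
      (hasDerivAt_entry dK i j).mul_const (p j)).mul_const (p i)
  have dF := dD.mul dQ
  simp only [dotK, Pi.mul_apply] at dF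
  rw [← hNdef, ← hh] at dF
  have hgen : (fun s => genFun (a s) (b s) t p) = ((fun s => (pencil (a s) (b s) t).det) *
      fun s => (a s).det) * fun s =>
        (((a s)⁻¹ * (pencil (a s) (b s) t)⁻¹ * (a s)⁻¹) *ᵥ p) ⬝ᵥ p := by
    funext s
    simp only [genFun, Pi.mul_apply, Matrix.mulVec_mulVec, mul_assoc]
  rw [hgen]
  refine dF.congr_deriv ?_
  have trN : (N⁻¹ * (-(Γ * N) - N * Γᵀ - t • (Matrix.vecMulVec X Λ + Matrix.vecMulVec Λ X))).trace
      = -(2 * Γ.trace) - 2 * t * ((N⁻¹ *ᵥ Λ) ⬝ᵥ X) := by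
    rw [mul_sub, mul_sub, Matrix.trace_sub, Matrix.trace_sub, mul_neg, Matrix.trace_neg,
      ← mul_assoc, Matrix.trace_mul_comm, ← mul_assoc, Matrix.mul_nonsing_inv _ hNu, one_mul,
      Matrix.nonsing_inv_mul_cancel_left _ _ hNu, Matrix.trace_transpose, mul_smul_comm,
      Matrix.trace_smul, mul_add, Matrix.trace_add, Matrix.mul_vecMulVec, Matrix.mul_vecMulVec,
      Matrix.trace_vecMulVec, Matrix.trace_vecMulVec]
    have : (N⁻¹ *ᵥ X) ⬝ᵥ Λ = (N⁻¹ *ᵥ Λ) ⬝ᵥ X := by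
      rw [← hNs, Matrix.mulVec_transpose, ← Matrix.dotProduct_mulVec, hNs, dotProduct_comm]
    rw [this, smul_eq_mul]
    ring
  have hK : (-(h * (N⁻¹ * (-(Γ * N) - N * Γᵀ -
      t • (Matrix.vecMulVec X Λ + Matrix.vecMulVec Λ X)) * N⁻¹)))
      = h * N⁻¹ * Γ + h * Γᵀ * N⁻¹
        + t • (Matrix.vecMulVec (h *ᵥ (N⁻¹ *ᵥ X)) (N⁻¹ *ᵥ Λ)
          + Matrix.vecMulVec (h *ᵥ (N⁻¹ *ᵥ Λ)) (N⁻¹ *ᵥ X)) := by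
    have e2 : ∀ z : Fin n → ℝ, z ᵥ* N⁻¹ = N⁻¹ *ᵥ z := fun z => by
      rw [← Matrix.mulVec_transpose, hNs]
    simp only [mul_sub, sub_mul, mul_neg, neg_mul, mul_add, add_mul, mul_smul_comm,
      smul_mul_assoc, Matrix.mul_vecMulVec, Matrix.vecMulVec_mul, e2]
    rw [Matrix.nonsing_inv_mul_cancel_left _ _ hNu, mul_assoc N⁻¹, mul_assoc Γ,
      Matrix.mul_nonsing_inv _ hNu, mul_one]
    simp only [mul_assoc]
    module
  have hsym : ∀ (A : Matrix (Fin n) (Fin n) ℝ) (y z : Fin n → ℝ),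
      (A *ᵥ y) ⬝ᵥ z = (Aᵀ *ᵥ z) ⬝ᵥ y := fun A y z => by
    rw [Matrix.mulVec_transpose, ← Matrix.dotProduct_mulVec, dotProduct_comm]
  have hq : (((-(Γ * h) - h * Γᵀ) * N⁻¹ + h * -(N⁻¹ * (-(Γ * N) - N * Γᵀ -
      t • (Matrix.vecMulVec X Λ + Matrix.vecMulVec Λ X)) * N⁻¹)) * h
      + h * N⁻¹ * (-(Γ * h) - h * Γᵀ)) *ᵥ p ⬝ᵥ p
      = -2 * ((Γ *ᵥ u) ⬝ᵥ p) + 2 * t * ((v ⬝ᵥ X) * (Λ ⬝ᵥ v)) := by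
    rw [mul_neg, hK]
    have e1 : ((-(Γ * h) - h * Γᵀ) * N⁻¹ + (h * N⁻¹ * Γ + h * Γᵀ * N⁻¹
        + t • (Matrix.vecMulVec (h *ᵥ (N⁻¹ *ᵥ X)) (N⁻¹ *ᵥ Λ)
          + Matrix.vecMulVec (h *ᵥ (N⁻¹ *ᵥ Λ)) (N⁻¹ *ᵥ X)))) * h
        + h * N⁻¹ * (-(Γ * h) - h * Γᵀ)
        = -(Γ * (h * (N⁻¹ * h))) - (h * (N⁻¹ * h)) * Γᵀ
        + t • (Matrix.vecMulVec (h *ᵥ (N⁻¹ *ᵥ X)) (h *ᵥ (N⁻¹ *ᵥ Λ))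
          + Matrix.vecMulVec (h *ᵥ (N⁻¹ *ᵥ Λ)) (h *ᵥ (N⁻¹ *ᵥ X))) := by
      have e2 : ∀ z : Fin n → ℝ, z ᵥ* h = h *ᵥ z := fun z => by
        rw [← Matrix.mulVec_transpose, hhs]
      simp only [mul_sub, sub_mul, mul_neg, neg_mul, add_mul, smul_mul_assoc,
        Matrix.vecMulVec_mul, e2, mul_assoc]
      module
    rw [e1, Matrix.add_mulVec, Matrix.sub_mulVec, Matrix.neg_mulVec, Matrix.smul_mulVec,
      Matrix.add_mulVec, Matrix.vecMulVec_mulVec, Matrix.vecMulVec_mulVec]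
    have e3 : (h * (N⁻¹ * h)) *ᵥ p = u := by
      rw [hu, hv, Matrix.mulVec_mulVec, Matrix.mulVec_mulVec, mul_assoc]
    have e4 : (h * (N⁻¹ * h))ᵀ = h * (N⁻¹ * h) := by
      rw [Matrix.transpose_mul, Matrix.transpose_mul, hhs, hNs, mul_assoc]
    have e5 : ((Γ * (h * (N⁻¹ * h))) *ᵥ p) = Γ *ᵥ u := by
      rw [← e3, Matrix.mulVec_mulVec]
    have e6 : (((h * (N⁻¹ * h)) * Γᵀ) *ᵥ p) ⬝ᵥ p = (Γ *ᵥ u) ⬝ᵥ p := by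
      rw [hsym, Matrix.transpose_mul, e4, Matrix.transpose_transpose, e5]
    have e7 : ∀ Z : Fin n → ℝ, (h *ᵥ (N⁻¹ *ᵥ Z)) ⬝ᵥ p = v ⬝ᵥ Z := by
      intro Z
      rw [hsym, hhs, dotProduct_comm, hsym, hNs, ← hv]
    simp only [add_dotProduct, sub_dotProduct, neg_dotProduct, smul_dotProduct, e5, e6, e7,
      MulOpposite.smul_eq_mul_unop, MulOpposite.unop_op, smul_eq_mul, dotProduct_comm Λ v]
    ring
  rw [trN, hq]
  have e3 : ((h * N⁻¹ * h) *ᵥ p) = u := by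
    rw [hu, hv, Matrix.mulVec_mulVec, Matrix.mulVec_mulVec, mul_assoc]
  rw [e3, hD]
  ring

/-- The derivative of the generating function in the momentum. -/
theorem hasDerivAt_genFun_momentum (A B : Matrix (Fin n) (Fin n) ℝ) (hA : Aᵀ = A) (hB : Bᵀ = B)
    (t : ℝ) (p X : Fin n → ℝ) :
    HasDerivAt (fun s : ℝ => genFun A B t (p + s • X))
      (2 * ((pencil A B t).det * A.det) *
        ((A⁻¹ *ᵥ ((pencil A B t)⁻¹ *ᵥ (A⁻¹ *ᵥ p))) ⬝ᵥ X)) 0 := by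
  set K := A⁻¹ * (pencil A B t)⁻¹ * A⁻¹ with hK
  have hKs : Kᵀ = K := by
    rw [hK, Matrix.transpose_mul, Matrix.transpose_mul, Matrix.transpose_nonsing_inv,
      Matrix.transpose_nonsing_inv, hA, transpose_pencil _ _ hA hB, mul_assoc]
  have h1 : (fun s : ℝ => genFun A B t (p + s • X)) = fun s =>
      (pencil A B t).det * A.det * ((K *ᵥ p) ⬝ᵥ p + s * (2 * ((K *ᵥ p) ⬝ᵥ X))
        + s ^ 2 * ((K *ᵥ X) ⬝ᵥ X)) := by
    funext s
    have e : (K *ᵥ X) ⬝ᵥ p = (K *ᵥ p) ⬝ᵥ X := by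
      rw [dotProduct_comm, Matrix.dotProduct_mulVec, ← Matrix.mulVec_transpose, hKs]
    rw [genFun, Matrix.mulVec_mulVec, Matrix.mulVec_mulVec, ← hK, Matrix.mulVec_add,
      Matrix.mulVec_smul]
    simp only [add_dotProduct, dotProduct_add, smul_dotProduct, dotProduct_smul, smul_eq_mul, e]
    ring
  rw [h1, Matrix.mulVec_mulVec, Matrix.mulVec_mulVec, ← hK]
  have h2 := ((((hasDerivAt_id (0 : ℝ)).mul_const (2 * ((K *ᵥ p) ⬝ᵥ X))).const_add
    ((K *ᵥ p) ⬝ᵥ p)).add (((hasDerivAt_id (0 : ℝ)).fun_pow 2).mul_const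
      ((K *ᵥ X) ⬝ᵥ X))).const_mul ((pencil A B t).det * A.det)
  refine h2.congr_deriv ?_
  simp
  ring

end Variation

end MatrixCalculus

/-! ### The algebraic identity behind the commutation -/

section Commutation

variable {n : ℕ}

/-- Pointwise form of `{F_t, F_s} = 0`: the `Γ`-terms cancel by the symmetry of the Christoffel
symbols, the rest by the resolvent identity
`(t - s) N_t⁻¹ g⁻¹ N_s⁻¹ = t N_t⁻¹ - s N_s⁻¹`. -/
theorem sum_bracket_eq_zero (A B : Matrix (Fin n) (Fin n) ℝ) (hA : Aᵀ = A) (hB : Bᵀ = B)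
    (hA0 : A.det ≠ 0) {t s : ℝ} (ht : (pencil A B t).det ≠ 0) (hs : (pencil A B s).det ≠ 0)
    (p Λ : Fin n → ℝ) (Γ : Fin n → Matrix (Fin n) (Fin n) ℝ)
    (hΓ : ∀ i j k, Γ i k j = Γ j k i) (D D' : ℝ)
    {v v' u u' : Fin n → ℝ} (hv : v = (pencil A B t)⁻¹ *ᵥ (A⁻¹ *ᵥ p)) (hu : u = A⁻¹ *ᵥ v)
    (hv' : v' = (pencil A B s)⁻¹ *ᵥ (A⁻¹ *ᵥ p)) (hu' : u' = A⁻¹ *ᵥ v') :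
    ∑ i, ((D * (2 * t * (v i * (Λ ⬝ᵥ v) - ((pencil A B t)⁻¹ *ᵥ Λ) i * (u ⬝ᵥ p)))
        - 2 * D * ((Γ i *ᵥ u) ⬝ᵥ p)) * (2 * D' * u' i)
      - (2 * D * u i) * (D' * (2 * s * (v' i * (Λ ⬝ᵥ v')
          - ((pencil A B s)⁻¹ *ᵥ Λ) i * (u' ⬝ᵥ p))) - 2 * D' * ((Γ i *ᵥ u') ⬝ᵥ p))) = 0 := by
  set N := pencil A B t with hN
  set N' := pencil A B s with hN'
  set h := A⁻¹ with hh
  have hNs : (N⁻¹)ᵀ = N⁻¹ := by rw [Matrix.transpose_nonsing_inv, transpose_pencil _ _ hA hB]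
  have hNs' : (N'⁻¹)ᵀ = N'⁻¹ := by rw [Matrix.transpose_nonsing_inv, transpose_pencil _ _ hA hB]
  have hhs : hᵀ = h := by rw [hh, Matrix.transpose_nonsing_inv, hA]
  have hsym : ∀ (Z : Matrix (Fin n) (Fin n) ℝ) (y z : Fin n → ℝ),
      (Z *ᵥ y) ⬝ᵥ z = (Zᵀ *ᵥ z) ⬝ᵥ y := fun Z y z => by
    rw [Matrix.mulVec_transpose, ← Matrix.dotProduct_mulVec, dotProduct_comm]
  have hcon : ∑ i, ((Γ i *ᵥ u) ⬝ᵥ p) * u' i = ∑ i, ((Γ i *ᵥ u') ⬝ᵥ p) * u i := by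
    have e : ∀ y z : Fin n → ℝ, ∑ i, ((Γ i *ᵥ y) ⬝ᵥ p) * z i
        = ∑ i, ∑ j, ∑ k, Γ i k j * p k * (y j * z i) := by
      intro y z
      refine Finset.sum_congr rfl fun i _ => ?_
      rw [Finset.sum_comm]
      simp only [dotProduct, Matrix.mulVec, Finset.sum_mul]
      exact Finset.sum_congr rfl fun k _ => Finset.sum_congr rfl fun j _ => by ring
    rw [e, e, Finset.sum_comm]
    refine Finset.sum_congr rfl fun i _ => Finset.sum_congr rfl fun j _ =>
      Finset.sum_congr rfl fun k _ => ?_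
    rw [hΓ j i k]
    ring
  -- the resolvent identity for two members of the pencil
  have hres : ∀ {P Q : Matrix (Fin n) (Fin n) ℝ} {x y : ℝ}, P.det ≠ 0 → Q.det ≠ 0 →
      P = pencil A B x → Q = pencil A B y →
      (x - y) • (P⁻¹ * h * Q⁻¹) = x • P⁻¹ - y • Q⁻¹ := by
    intro P Q x y hP hQ eP eQ
    have e1 : (x - y) • h = x • Q - y • P := by
      rw [eP, eQ, pencil, pencil, smul_sub, smul_sub, smul_smul, smul_smul, mul_comm y x]
      module
    have e2 : (x - y) • (P⁻¹ * h * Q⁻¹) = P⁻¹ * ((x - y) • h) * Q⁻¹ := by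
      rw [mul_smul_comm, smul_mul_assoc]
    rw [e2, e1, mul_sub, sub_mul, mul_smul_comm, mul_smul_comm, smul_mul_assoc, smul_mul_assoc,
      Matrix.mul_nonsing_inv_cancel_right _ _ hQ.isUnit, Matrix.nonsing_inv_mul _ hP.isUnit,
      one_mul]
  have hcomm : N⁻¹ * h * N'⁻¹ = N'⁻¹ * h * N⁻¹ := by
    have e : N' * A * N = N * A * N' := by
      have hAu := hA0.isUnit
      simp only [hN, hN', pencil, sub_mul, mul_sub, smul_mul_assoc, mul_smul_comm,
        Matrix.nonsing_inv_mul _ hAu, Matrix.mul_nonsing_inv_cancel_right _ _ hAu, one_mul]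
      module
    have := congrArg (fun Z => Z⁻¹) e
    simpa only [Matrix.mul_inv_rev, mul_assoc] using this
  set w := N⁻¹ *ᵥ u' with hw
  have hw1 : w = (N⁻¹ * h * N'⁻¹) *ᵥ (h *ᵥ p) := by
    rw [hw, hu', hv', Matrix.mulVec_mulVec, Matrix.mulVec_mulVec, mul_assoc]
  have hw2 : N'⁻¹ *ᵥ u = w := by
    rw [hw1, hcomm, hu, hv, Matrix.mulVec_mulVec, Matrix.mulVec_mulVec, mul_assoc]
  have hvw : (t - s) • w = t • v - s • v' := by
    rw [hw1, ← Matrix.smul_mulVec, hres ht hs hN hN', Matrix.sub_mulVec, Matrix.smul_mulVec,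
      Matrix.smul_mulVec, ← hv, ← hv']
  have c1 : v ⬝ᵥ u' = (h *ᵥ w) ⬝ᵥ p := by
    rw [hw, hv, hsym, hNs, dotProduct_comm, hsym, hhs]
  have c2 : v' ⬝ᵥ u = (h *ᵥ w) ⬝ᵥ p := by
    rw [← hw2, hv', hsym, hNs', dotProduct_comm, hsym, hhs]
  have l1 : (N⁻¹ *ᵥ Λ) ⬝ᵥ u' = Λ ⬝ᵥ w := by rw [hsym, hNs, dotProduct_comm]
  have l2 : (N'⁻¹ *ᵥ Λ) ⬝ᵥ u = Λ ⬝ᵥ w := by rw [hsym, hNs', hw2, dotProduct_comm]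
  have m1 : t * (Λ ⬝ᵥ v) - s * (Λ ⬝ᵥ v') = (t - s) * (Λ ⬝ᵥ w) := by
    rw [← smul_eq_mul, ← smul_eq_mul, ← smul_eq_mul, ← dotProduct_smul, ← dotProduct_smul,
      ← dotProduct_sub, ← hvw, dotProduct_smul]
  have m2 : t * (u ⬝ᵥ p) - s * (u' ⬝ᵥ p) = (t - s) * ((h *ᵥ w) ⬝ᵥ p) := by
    rw [hu, hu', ← smul_eq_mul, ← smul_eq_mul, ← smul_eq_mul, ← smul_dotProduct,
      ← smul_dotProduct, ← sub_dotProduct, ← Matrix.mulVec_smul, ← Matrix.mulVec_smul,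
      ← Matrix.mulVec_sub, ← hvw, Matrix.mulVec_smul, smul_dotProduct]
  have expand : ∑ i, ((D * (2 * t * (v i * (Λ ⬝ᵥ v) - (N⁻¹ *ᵥ Λ) i * (u ⬝ᵥ p)))
        - 2 * D * ((Γ i *ᵥ u) ⬝ᵥ p)) * (2 * D' * u' i)
      - (2 * D * u i) * (D' * (2 * s * (v' i * (Λ ⬝ᵥ v')
          - (N'⁻¹ *ᵥ Λ) i * (u' ⬝ᵥ p))) - 2 * D' * ((Γ i *ᵥ u') ⬝ᵥ p)))
      = 4 * D * D' * (t * ((v ⬝ᵥ u') * (Λ ⬝ᵥ v) - ((N⁻¹ *ᵥ Λ) ⬝ᵥ u') * (u ⬝ᵥ p))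
        - s * ((v' ⬝ᵥ u) * (Λ ⬝ᵥ v') - ((N'⁻¹ *ᵥ Λ) ⬝ᵥ u) * (u' ⬝ᵥ p))
        - ∑ i, ((Γ i *ᵥ u) ⬝ᵥ p) * u' i + ∑ i, ((Γ i *ᵥ u') ⬝ᵥ p) * u i) := by
    rw [show v ⬝ᵥ u' = ∑ i, v i * u' i from rfl, show v' ⬝ᵥ u = ∑ i, v' i * u i from rfl,
      show (N⁻¹ *ᵥ Λ) ⬝ᵥ u' = ∑ i, (N⁻¹ *ᵥ Λ) i * u' i from rfl,
      show (N'⁻¹ *ᵥ Λ) ⬝ᵥ u = ∑ i, (N'⁻¹ *ᵥ Λ) i * u i from rfl]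
    simp only [Finset.mul_sum, Finset.sum_mul, ← Finset.sum_add_distrib,
      ← Finset.sum_sub_distrib]
    exact Finset.sum_congr rfl fun i _ => by ring
  rw [expand, hcon, c1, c2, l1, l2]
  linear_combination 4 * D * D' * ((h *ᵥ w) ⬝ᵥ p) * m1 - 4 * D * D' * (Λ ⬝ᵥ w) * m2

end Commutation

/-! ### Metrics and integrals in a chart -/

section Charts

variable {n : ℕ} {M : Type*} [TopologicalSpace M] [ChartedSpace (E n) M]

theorem mdifferentiable_of_mem_charts {e : OpenPartialHomeomorph M (E n)} (he : e ∈ charts n M) :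
    e.MDifferentiable 𝓘(ℝ, E n) 𝓘(ℝ, E n) :=
  ⟨(contMDiffOn_of_mem_maximalAtlas he).mdifferentiableOn (by simp),
    (contMDiffOn_symm_of_mem_maximalAtlas he).mdifferentiableOn (by simp)⟩

theorem apply_sum_smul_sum_smul {V : Type*} [AddCommGroup V] [Module ℝ V] [TopologicalSpace V]
    (B : V →L[ℝ] V →L[ℝ] ℝ) (u w : Fin n → ℝ) (x : Fin n → V) :
    B (∑ i, u i • x i) (∑ j, w j • x j) = ∑ i, ∑ j, u i * w j * B (x i) (x j) := by
  rw [map_sum, Finset.sum_comm]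
  refine Finset.sum_congr rfl fun j _ => ?_
  rw [map_smul, map_sum, sum_apply, Finset.smul_sum]
  refine Finset.sum_congr rfl fun i _ => ?_
  rw [map_smul, smul_apply, smul_smul, smul_eq_mul, mul_comm (w j)]

theorem sum_smul_stdVec (u : E n) : ∑ i, u i • stdVec i = u := by
  ext j
  simp [stdVec, Pi.single_apply]

theorem mfderiv_symm_eq_sum (e : OpenPartialHomeomorph M (E n)) (q u : E n) :
    mfderiv 𝓘(ℝ, E n) 𝓘(ℝ, E n) e.symm q u = ∑ i, u i • coordVec e q i := by
  let L : E n →L[ℝ] TangentSpace 𝓘(ℝ, E n) (e.symm q) :=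
    mfderiv 𝓘(ℝ, E n) 𝓘(ℝ, E n) e.symm q
  have h : L u = ∑ i, u i • L (stdVec i) := by
    conv_lhs => rw [← sum_smul_stdVec u, map_sum]
    exact Finset.sum_congr rfl fun i _ => map_smul _ _ _
  exact h

theorem mfderiv_symm_injective {e : OpenPartialHomeomorph M (E n)} (he : e ∈ charts n M)
    {q : E n} (hq : q ∈ e.target) :
    Function.Injective (mfderiv 𝓘(ℝ, E n) 𝓘(ℝ, E n) e.symm q) :=
  (mdifferentiable_of_mem_charts he).symm.mfderiv_injective hq

theorem ofCanonical_snd_coordVec {e : OpenPartialHomeomorph M (E n)} (he : e ∈ charts n M)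
    {q : E n} (hq : q ∈ e.target) (p : E n) (i : Fin n) :
    (ofCanonical e (q, p)).2 (coordVec e q i) = p i := by
  have h := (mdifferentiable_of_mem_charts he).comp_symm_deriv hq
  have h1 : mfderiv 𝓘(ℝ, E n) 𝓘(ℝ, E n) e (e.symm q) (coordVec e q i) = stdVec i :=
    DFunLike.congr_fun h (stdVec i)
  have h2 : (ofCanonical e (q, p)).2 (coordVec e q i)
      = innerSL ℝ p (mfderiv 𝓘(ℝ, E n) 𝓘(ℝ, E n) e (e.symm q) (coordVec e q i)) := rfl
  rw [h2, h1]
  simp [stdVec, EuclideanSpace.inner_single_right]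

theorem ofCanonical_toCanonical {e : OpenPartialHomeomorph M (E n)} (he : e ∈ charts n M)
    {z : Cotangent n M} (hz : z.1 ∈ e.source) : ofCanonical e (toCanonical e z) = z := by
  obtain ⟨x, P⟩ := z
  have hx : x ∈ e.source := hz
  have hL : (toCanonical e ⟨x, P⟩).1 = e x := rfl
  unfold ofCanonical
  rw [hL, e.left_inv hx]
  congr 1
  ext u
  have h1 := (mdifferentiable_of_mem_charts he).symm_comp_deriv hx
  set L : E n →L[ℝ] TangentSpace 𝓘(ℝ, E n) x :=
    mfderiv 𝓘(ℝ, E n) 𝓘(ℝ, E n) e.symm (e x) with hLdef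
  have h2 : ∀ w : E n, innerSL ℝ (toCanonical e ⟨x, P⟩).2 w = P (L w) := by
    intro w
    conv_rhs => rw [← sum_smul_stdVec w, map_sum, map_sum]
    rw [innerSL_apply_apply, PiLp.inner_apply]
    refine Finset.sum_congr rfl fun i _ => ?_
    rw [map_smul, map_smul]
    rfl
  exact (h2 _).trans (congrArg P (DFunLike.congr_fun h1 u))

variable [IsManifold 𝓘(ℝ, E n) ∞ M]

/-- The scalar product of two vectors of `ℝⁿ`, seen as tangent vectors at the point with
coordinates `q`. -/
noncomputable def chartForm (g : Metric n M) (e : OpenPartialHomeomorph M (E n)) (q u w : E n) :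
    ℝ :=
  g.inner (e.symm q) (mfderiv 𝓘(ℝ, E n) 𝓘(ℝ, E n) e.symm q u)
    (mfderiv 𝓘(ℝ, E n) 𝓘(ℝ, E n) e.symm q w)

theorem chartForm_eq_sum (g : Metric n M) (e : OpenPartialHomeomorph M (E n)) (q u w : E n) :
    chartForm g e q u w = ∑ i, ∑ j, u i * w j * chartMatrix g e q i j := by
  rw [chartForm, mfderiv_symm_eq_sum, mfderiv_symm_eq_sum, apply_sum_smul_sum_smul]
  rfl

theorem chartForm_eq_dotProduct (g : Metric n M) (e : OpenPartialHomeomorph M (E n))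
    (q u w : E n) : chartForm g e q u w = ⇑u ⬝ᵥ (chartMatrix g e q *ᵥ ⇑w) := by
  rw [chartForm_eq_sum]
  simp only [dotProduct, Matrix.mulVec, Finset.mul_sum]
  exact Finset.sum_congr rfl fun i _ => Finset.sum_congr rfl fun j _ => by ring

theorem transpose_chartMatrix (g : Metric n M) (e : OpenPartialHomeomorph M (E n)) (q : E n) :
    (chartMatrix g e q)ᵀ = chartMatrix g e q := by
  ext i j
  exact g.symm _ _ _

theorem posDef_chartMatrix (g : Metric n M) {e : OpenPartialHomeomorph M (E n)}
    (he : e ∈ charts n M) {q : E n} (hq : q ∈ e.target) : (chartMatrix g e q).PosDef := by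
  refine Matrix.PosDef.of_dotProduct_mulVec_pos ?_ fun x hx => ?_
  · rw [Matrix.IsHermitian, Matrix.conjTranspose_eq_transpose_of_trivial, transpose_chartMatrix]
  · have h := chartForm_eq_dotProduct g e q (WithLp.toLp 2 x) (WithLp.toLp 2 x)
    simp only [star_trivial]
    rw [← h]
    refine g.pos _ _ fun h0 => hx ?_
    have h1 : (WithLp.toLp 2 x : E n) = 0 :=
      mfderiv_symm_injective he hq (h0.trans (map_zero _).symm)
    simpa using h1

theorem det_chartMatrix_pos (g : Metric n M) {e : OpenPartialHomeomorph M (E n)}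
    (he : e ∈ charts n M) {q : E n} (hq : q ∈ e.target) : 0 < (chartMatrix g e q).det :=
  (posDef_chartMatrix g he hq).det_pos

theorem contDiffOn_chartMatrix (g : Metric n M) {e : OpenPartialHomeomorph M (E n)}
    (he : e ∈ charts n M) (i j : Fin n) :
    ContDiffOn ℝ 2 (fun q => chartMatrix g e q i j) e.target := by
  have hsymm := contMDiffOn_symm_of_mem_maximalAtlas he
  have hcoord : ∀ i : Fin n, ContMDiffOn 𝓘(ℝ, E n) (𝓘(ℝ, E n).prod 𝓘(ℝ, E n)) 2
      (fun q => TotalSpace.mk' (E n) (E := fun x : M => TangentSpace 𝓘(ℝ, E n) x)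
        (e.symm q) (coordVec e q i)) e.target := by
    intro i
    have h1 := hsymm.contMDiffOn_tangentMapWithin (m := 2) (by norm_cast)
      e.open_target.uniqueMDiffOn
    have h2 : ContMDiffOn 𝓘(ℝ, E n) (𝓘(ℝ, E n).prod 𝓘(ℝ, E n)) 2
        (fun q : E n => TotalSpace.mk' (E n) (E := fun x : E n => TangentSpace 𝓘(ℝ, E n) x)
          q (stdVec i)) e.target := fun q _ =>
      contMDiffWithinAt_vectorSpace_iff_contDiffWithinAt.2 contDiffWithinAt_const
    have h3 := h1.comp h2 (fun q hq => hq)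
    refine h3.congr fun q hq => ?_
    simp only [Function.comp, tangentMapWithin, coordVec]
    rw [mfderivWithin_of_isOpen e.open_target hq]
  have hg := g.contMDiff.comp_contMDiffOn (hsymm.of_le (m := 2) (by norm_cast))
  have h := ContMDiffOn.clm_bundle_apply₂ (F₁ := E n) (F₂ := E n) (F₃ := ℝ)
    (E₁ := fun x : M => TangentSpace 𝓘(ℝ, E n) x) (E₂ := fun x : M => TangentSpace 𝓘(ℝ, E n) x)
    (E₃ := Bundle.Trivial M ℝ) (b := e.symm) (ψ := fun q => g.inner (e.symm q))
    hg (hcoord i) (hcoord j)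
  intro q hq
  have h' := h q hq
  rw [contMDiffWithinAt_totalSpace] at h'
  exact h'.2.contDiffWithinAt

theorem contDiffAt_chartMatrix (g : Metric n M) {e : OpenPartialHomeomorph M (E n)}
    (he : e ∈ charts n M) {q : E n} (hq : q ∈ e.target) (i j : Fin n) :
    ContDiffAt ℝ 2 (fun q => chartMatrix g e q i j) q :=
  (contDiffOn_chartMatrix g he i j).contDiffAt (e.open_target.mem_nhds hq)

/-! ### The integrals in canonical coordinates -/

theorem inner_eq_dotProduct_gram (g : Metric n M) (x : M) (v w : TangentSpace 𝓘(ℝ, E n) x) :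
    g.inner x v w = (tangentBasis x).repr v ⬝ᵥ (gram g x *ᵥ (tangentBasis x).repr w) := by
  conv_lhs => rw [← (tangentBasis x).sum_repr v, ← (tangentBasis x).sum_repr w]
  rw [apply_sum_smul_sum_smul]
  simp only [dotProduct, Matrix.mulVec, Finset.mul_sum]
  refine Finset.sum_congr rfl fun i _ => Finset.sum_congr rfl fun j _ => ?_
  rw [gram, Matrix.of_apply]
  ring

theorem transpose_gram (g : Metric n M) (x : M) : (gram g x)ᵀ = gram g x := by
  ext i j
  exact g.symm _ _ _

theorem det_gram_pos (g : Metric n M) (x : M) : 0 < (gram g x).det := by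
  refine Matrix.PosDef.det_pos (Matrix.PosDef.of_dotProduct_mulVec_pos ?_ fun z hz => ?_)
  · rw [Matrix.IsHermitian, Matrix.conjTranspose_eq_transpose_of_trivial, transpose_gram]
  · have h := inner_eq_dotProduct_gram g x ((tangentBasis x).equivFun.symm z)
      ((tangentBasis x).equivFun.symm z)
    have e1 : ⇑((tangentBasis x).repr ((tangentBasis x).equivFun.symm z)) = z :=
      (tangentBasis x).equivFun.apply_symm_apply z
    rw [e1] at h
    simp only [star_trivial]
    rw [← h]
    refine g.pos _ _ fun h0 => hz ?_
    exact (tangentBasis x).equivFun.symm.map_eq_zero_iff.1 h0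

theorem repr_sharp (g : Metric n M) (x : M) (p : TangentSpace 𝓘(ℝ, E n) x →L[ℝ] ℝ) :
    ⇑((tangentBasis x).repr (sharp g x p)) = (gram g x)⁻¹ *ᵥ fun j => p (tangentBasis x j) := by
  rw [sharp]
  exact congrArg _ rfl |>.trans ((tangentBasis x).repr_sum_self _)

theorem toMatrix_opS (g g' : Metric n M) (k : ℕ) (x : M) :
    LinearMap.toMatrix (tangentBasis x) (tangentBasis x) (opS g g' k x)
      = matS k (gram g x) (gram g' x) := by
  have hG : LinearMap.toMatrix (tangentBasis x) (tangentBasis x) (opG g g' x)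
      = (gram g x)⁻¹ * gram g' x := by
    rw [opG, LinearMap.toMatrix_toLin]
  rw [opS, matS, map_smul, map_sum]
  congr 1
  refine Finset.sum_congr rfl fun i _ => ?_
  have hpow : LinearMap.toMatrix (tangentBasis x) (tangentBasis x) (opG g g' x ^ (k - i + 1))
      = LinearMap.toMatrix (tangentBasis x) (tangentBasis x) (opG g g' x) ^ (k - i + 1) :=
    (LinearMap.toMatrix_pow (tangentBasis x) (opG g g' x) _).symm
  rw [map_smul, hpow, hG, charCoeff, charPolyG, hG, detSubX]

theorem integralI_eq_matIntegral (g g' : Metric n M) (k : ℕ) (x : M)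
    (p : TangentSpace 𝓘(ℝ, E n) x →L[ℝ] ℝ) :
    integralI g g' k ⟨x, p⟩
      = matIntegral k (gram g x) (gram g' x) (fun j => p (tangentBasis x j)) := by
  rw [integralI, inner_eq_dotProduct_gram, repr_sharp, matIntegral,
    Matrix.mulVec_mulVec, Matrix.mul_nonsing_inv _ (det_gram_pos g x).ne'.isUnit,
    Matrix.one_mulVec]
  congr 1
  rw [← LinearMap.toMatrix_mulVec_repr (tangentBasis x) (tangentBasis x), toMatrix_opS, repr_sharp]

theorem hamiltonian_eq (g : Metric n M) (x : M) (p : TangentSpace 𝓘(ℝ, E n) x →L[ℝ] ℝ) :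
    hamiltonian g ⟨x, p⟩ = (1 / 2) * (((gram g x)⁻¹ *ᵥ fun j => p (tangentBasis x j))
      ⬝ᵥ fun j => p (tangentBasis x j)) := by
  rw [hamiltonian, inner_eq_dotProduct_gram, repr_sharp,
    Matrix.mulVec_mulVec, Matrix.mul_nonsing_inv _ (det_gram_pos g x).ne'.isUnit,
    Matrix.one_mulVec]

theorem integralI_last (g g' : Metric n M) {k : ℕ} (hk : k + 1 = n) (z : Cotangent n M) :
    integralI g g' k z = -2 * hamiltonian g z := by
  obtain ⟨x, p⟩ := z
  rw [integralI_eq_matIntegral, hamiltonian_eq,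
    matIntegral_last (det_gram_pos g x) (det_gram_pos g' x) _ hk]
  ring

/-- The Jacobian matrix of the inverse chart, in the basis `tangentBasis`. -/
noncomputable def jacobianMatrix (e : OpenPartialHomeomorph M (E n)) (q : E n) :
    Matrix (Fin n) (Fin n) ℝ :=
  Matrix.of fun i j => (tangentBasis (e.symm q)).repr (coordVec e q j) i

theorem chartMatrix_eq (g : Metric n M) (e : OpenPartialHomeomorph M (E n)) (q : E n) :
    chartMatrix g e q = (jacobianMatrix e q)ᵀ * gram g (e.symm q) * jacobianMatrix e q := by
  ext i j
  rw [chartMatrix, Matrix.of_apply, inner_eq_dotProduct_gram, mul_assoc, Matrix.mul_apply]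
  rfl

theorem isUnit_det_jacobianMatrix (g : Metric n M) {e : OpenPartialHomeomorph M (E n)}
    (he : e ∈ charts n M) {q : E n} (hq : q ∈ e.target) : IsUnit (jacobianMatrix e q).det := by
  have h := (det_chartMatrix_pos g he hq).ne'
  rw [chartMatrix_eq, Matrix.det_mul] at h
  exact (right_ne_zero_of_mul h).isUnit

theorem inCoords_integralI (g g' : Metric n M) {e : OpenPartialHomeomorph M (E n)}
    (he : e ∈ charts n M) (k : ℕ) {q : E n} (hq : q ∈ e.target) (p : E n) :
    inCoords e (integralI g g' k) (q, p)
      = matIntegral k (chartMatrix g e q) (chartMatrix g' e q) p := by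
  have h1 : inCoords e (integralI g g' k) (q, p) = matIntegral k (gram g (e.symm q))
      (gram g' (e.symm q)) (fun j => (ofCanonical e (q, p)).2 (tangentBasis (e.symm q) j)) :=
    integralI_eq_matIntegral g g' k (e.symm q) _
  rw [h1, chartMatrix_eq g, chartMatrix_eq g',
    ← matIntegral_conj k _ _ _ (isUnit_det_jacobianMatrix g he hq)]
  congr 1
  ext i
  rw [← ofCanonical_snd_coordVec he hq p i]
  let P : TangentSpace 𝓘(ℝ, E n) (e.symm q) →L[ℝ] ℝ := (ofCanonical e (q, p)).2
  have hP : P (coordVec e q i) = ∑ j, (tangentBasis (e.symm q)).repr (coordVec e q i) j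
      * P (tangentBasis (e.symm q) j) := by
    conv_lhs => rw [← (tangentBasis (e.symm q)).sum_repr (coordVec e q i), map_sum]
    exact Finset.sum_congr rfl fun j _ => map_smul _ _ _
  exact hP.symm

/-- The generating function in canonical coordinates. -/
noncomputable def genCoords (g g' : Metric n M) (e : OpenPartialHomeomorph M (E n)) (t : ℝ)
    (w : E n × E n) : ℝ :=
  genFun (chartMatrix g e w.1) (chartMatrix g' e w.1) t w.2

theorem contDiffAt_genCoords (g g' : Metric n M) {e : OpenPartialHomeomorph M (E n)}
    (he : e ∈ charts n M) {q : E n} (hq : q ∈ e.target) (p : E n) {t : ℝ}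
    (ht : (pencil (chartMatrix g e q) (chartMatrix g' e q) t).det ≠ 0) :
    ContDiffAt ℝ 2 (genCoords g g' e t) (q, p) := by
  have hm : ∀ g : Metric n M, open scoped Matrix.Norms.Operator in
      ContDiffAt ℝ 2 (fun w : E n × E n => chartMatrix g e w.1) (q, p) := fun g =>
    contDiffAt_matrix_of_entries fun i j =>
      (contDiffAt_chartMatrix g he hq i j).comp (q, p) contDiffAt_fst
  refine contDiffAt_genFun (hm g) (hm g') (det_chartMatrix_pos g he hq)
    (det_chartMatrix_pos g' he hq) ht (p := fun w => ⇑w.2) fun i => ?_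
  exact ((EuclideanSpace.proj i : E n →L[ℝ] ℝ).contDiff.comp contDiff_snd).contDiffAt

/-- Near any point the integrals are combinations with constant coefficients of generating
functions with a common set of `n` distinct nodes, at which the pencil is invertible. -/
theorem exists_nodes (g g' : Metric n M) {e : OpenPartialHomeomorph M (E n)}
    (he : e ∈ charts n M) {q : E n} (hq : q ∈ e.target) :
    ∃ v : Fin n → ℝ,
      (∀ j, (pencil (chartMatrix g e q) (chartMatrix g' e q) (v j)).det ≠ 0) ∧
      ∀ k < n, ∃ c : Fin n → ℝ, ∀ p : E n, inCoords e (integralI g g' k) =ᶠ[𝓝 (q, p)]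
        fun w => ∑ j, c j * genCoords g g' e (v j) w := by
  set a := chartMatrix g e q with ha
  set b := chartMatrix g' e q with hb
  have hcont : Continuous fun t : ℝ => (pencil a b t).det := by
    unfold pencil
    fun_prop
  have h0 : (pencil a b 0).det ≠ 0 := by
    rw [pencil_zero, Matrix.det_nonsing_inv, Ring.inverse_eq_inv']
    exact inv_ne_zero (det_chartMatrix_pos g he hq).ne'
  -- `N_0 = a⁻¹` is invertible, so all small `t` can serve as nodes
  have hopen : {t : ℝ | (pencil a b t).det ≠ 0} ∈ 𝓝 (0 : ℝ) :=
    hcont.continuousAt.eventually_ne h0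
  have hinf : {t : ℝ | (pencil a b t).det ≠ 0}.Infinite := infinite_of_mem_nhds 0 hopen
  set v : Fin n → ℝ := fun j => hinf.natEmbedding _ (j : ℕ) with hv
  have hvinj : Function.Injective v := fun i j hij =>
    Fin.ext ((hinf.natEmbedding _).injective (Subtype.ext hij))
  have hvdet : ∀ j, (pencil a b (v j)).det ≠ 0 := fun j => (hinf.natEmbedding _ (j : ℕ)).2
  refine ⟨v, hvdet, fun k hk =>
    ⟨fun j => -(Lagrange.basis Finset.univ v j).coeff (n - 1 - k), fun p => ?_⟩⟩
  have hm : ∀ g : Metric n M, open scoped Matrix.Norms.Operator in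
      ContDiffAt ℝ 2 (fun w : E n × E n => chartMatrix g e w.1) (q, p) := fun g =>
    contDiffAt_matrix_of_entries fun i j =>
      (contDiffAt_chartMatrix g he hq i j).comp (q, p) contDiffAt_fst
  have hne : ∀ᶠ w : E n × E n in 𝓝 (q, p),
      ∀ j, (pencil (chartMatrix g e w.1) (chartMatrix g' e w.1) (v j)).det ≠ 0 := by
    rw [eventually_all]
    intro j
    have := (contDiffAt_matrix_det (contDiffAt_pencil (hm g) (hm g')
      (det_chartMatrix_pos g he hq) (det_chartMatrix_pos g' he hq) (v j))).continuousAt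
    exact this.eventually_ne (hvdet j)
  have htar : ∀ᶠ w : E n × E n in 𝓝 (q, p), w.1 ∈ e.target :=
    continuousAt_fst.eventually (e.open_target.mem_nhds hq)
  filter_upwards [hne, htar] with w hw hwt
  obtain ⟨q', p'⟩ := w
  rw [inCoords_integralI g g' he k hwt p', matIntegral_eq_sum_genFun
    (det_chartMatrix_pos g he hwt) (det_chartMatrix_pos g' he hwt) _ hvinj hw hk]
  rfl

theorem isC2_integralI (g g' : Metric n M) {k : ℕ} (hk : k < n) : IsC2 (integralI g g' k) := by
  rintro e he ⟨q, p⟩ ⟨hq, -⟩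
  obtain ⟨v, hv, hc⟩ := exists_nodes g g' he hq
  obtain ⟨c, hc⟩ := hc k hk
  refine ContDiffAt.contDiffWithinAt (ContDiffAt.congr_of_eventuallyEq ?_ (hc p))
  exact ContDiffAt.sum fun j _ => contDiffAt_const.mul (contDiffAt_genCoords g g' he hq p (hv j))

theorem exists_quadraticForm (g g' : Metric n M) (k : ℕ) (x : M) :
    ∃ Q : QuadraticForm ℝ (TangentSpace 𝓘(ℝ, E n) x →L[ℝ] ℝ),
      ∀ p, integralI g g' k ⟨x, p⟩ = Q p := by
  let f : (TangentSpace 𝓘(ℝ, E n) x →L[ℝ] ℝ) →ₗ[ℝ] (Fin n → ℝ) :=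
    { toFun := fun p j => p (tangentBasis x j)
      map_add' := fun _ _ => rfl
      map_smul' := fun _ _ => rfl }
  let B : LinearMap.BilinForm ℝ (Fin n → ℝ) :=
    Matrix.toLinearMap₂' ℝ (matS k (gram g x) (gram g' x) * (gram g x)⁻¹)
  refine ⟨(LinearMap.BilinMap.toQuadraticMap B).comp f, fun p => ?_⟩
  rw [integralI_eq_matIntegral, matIntegral, QuadraticMap.comp_apply,
    LinearMap.BilinMap.toQuadraticMap_apply, Matrix.toLinearMap₂'_apply', Matrix.mulVec_mulVec,
    dotProduct_comm]
  rfl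

end Charts

/-! ### Change of chart -/

section Connection

variable {n : ℕ} {M : Type*} [TopologicalSpace M] [ChartedSpace (E n) M]

theorem contDiffAt_transition {e e' : OpenPartialHomeomorph M (E n)} (he : e ∈ charts n M)
    (he' : e' ∈ charts n M) {q : E n} (hq : q ∈ e.target) (hq' : e.symm q ∈ e'.source) :
    ContDiffAt ℝ ∞ (e' ∘ e.symm) q :=
  ((contMDiffAt_of_mem_maximalAtlas he' hq').comp q
    (contMDiffAt_symm_of_mem_maximalAtlas he hq)).contDiffAt

theorem fderiv_transition {e e' : OpenPartialHomeomorph M (E n)} (he : e ∈ charts n M)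
    (he' : e' ∈ charts n M) {q : E n} (hq : q ∈ e.target) (hq' : e.symm q ∈ e'.source) (u : E n) :
    fderiv ℝ (e' ∘ e.symm) q u = mfderiv 𝓘(ℝ, E n) 𝓘(ℝ, E n) e' (e.symm q)
      (mfderiv 𝓘(ℝ, E n) 𝓘(ℝ, E n) e.symm q u) := by
  rw [← mfderiv_eq_fderiv, mfderiv_comp q
    ((mdifferentiable_of_mem_charts he').mdifferentiableAt hq')
    ((mdifferentiable_of_mem_charts he).mdifferentiableAt_symm hq)]
  rfl

theorem fderiv_transition_surjective {e e' : OpenPartialHomeomorph M (E n)} (he : e ∈ charts n M)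
    (he' : e' ∈ charts n M) {q : E n} (hq : q ∈ e.target) (hq' : e.symm q ∈ e'.source) :
    Function.Surjective (fderiv ℝ (e' ∘ e.symm) q) := by
  intro w
  obtain ⟨v, hv⟩ := (mdifferentiable_of_mem_charts he').mfderiv_surjective hq' w
  obtain ⟨u, hu⟩ := (mdifferentiable_of_mem_charts he).symm.mfderiv_surjective
    (x := q) hq v
  exact ⟨u, (fderiv_transition he he' hq hq' u).trans ((congrArg _ hu).trans hv)⟩

variable [IsManifold 𝓘(ℝ, E n) ∞ M]

/-! ### The Levi-Civita connection in charts -/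

/-- The vector `Γ(u, u)` with components `Γ^k_{ij} u^i u^j`. -/
noncomputable def chrisVec (g : Metric n M) (e : OpenPartialHomeomorph M (E n)) (q u : E n) :
    E n :=
  WithLp.toLp 2 fun k => ∑ i, ∑ j, christoffel g e q k i j * u i * u j

/-- The derivative in direction `v` of the scalar product of the constant fields `u` and `w`. -/
noncomputable def dChartForm (g : Metric n M) (e : OpenPartialHomeomorph M (E n))
    (q v u w : E n) : ℝ :=
  ∑ i, ∑ j, u i * w j * ∑ l, v l * dChartMatrix g e q l i j

theorem chartMatrix_symm (g : Metric n M) (e : OpenPartialHomeomorph M (E n)) (q : E n)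
    (i j : Fin n) : chartMatrix g e q i j = chartMatrix g e q j i := g.symm _ _ _

theorem dChartMatrix_symm (g : Metric n M) (e : OpenPartialHomeomorph M (E n)) (q : E n)
    (l i j : Fin n) : dChartMatrix g e q l i j = dChartMatrix g e q l j i := by
  unfold dChartMatrix
  simp only [chartMatrix_symm g e _ i j]

theorem christoffel_symm (g : Metric n M) (e : OpenPartialHomeomorph M (E n)) (q : E n)
    (k i j : Fin n) : christoffel g e q k i j = christoffel g e q k j i := by
  unfold christoffel
  congr 1
  refine Finset.sum_congr rfl fun l _ => ?_
  rw [dChartMatrix_symm g e q l i j]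
  ring

/-- The Christoffel symbols of the first kind. -/
theorem sum_chartMatrix_mul_christoffel (g : Metric n M) {e : OpenPartialHomeomorph M (E n)}
    (he : e ∈ charts n M) {q : E n} (hq : q ∈ e.target) (m i j : Fin n) :
    ∑ k, chartMatrix g e q m k * christoffel g e q k i j
      = (1 / 2) * (dChartMatrix g e q i j m + dChartMatrix g e q j i m
        - dChartMatrix g e q m i j) := by
  have hu := (det_chartMatrix_pos g he hq).ne'.isUnit
  set d : Fin n → ℝ := fun l =>
    dChartMatrix g e q i j l + dChartMatrix g e q j i l - dChartMatrix g e q l i j with hd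
  have h : chartMatrix g e q *ᵥ ((chartMatrix g e q)⁻¹ *ᵥ d) = d := by
    rw [Matrix.mulVec_mulVec, Matrix.mul_nonsing_inv _ hu, Matrix.one_mulVec]
  have h1 := congrFun h m
  have h2 : (1 / 2) * (dChartMatrix g e q i j m + dChartMatrix g e q j i m
      - dChartMatrix g e q m i j) = (1 / 2) * d m := rfl
  rw [h2, ← h1]
  simp only [Matrix.mulVec, dotProduct, christoffel, Finset.mul_sum]
  refine Finset.sum_congr rfl fun k _ => Finset.sum_congr rfl fun l _ => ?_
  simp only [hd]
  ring

theorem chartForm_symm (g : Metric n M) (e : OpenPartialHomeomorph M (E n)) (q u w : E n) :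
    chartForm g e q u w = chartForm g e q w u := g.symm _ _ _

theorem chartForm_add_left (g : Metric n M) (e : OpenPartialHomeomorph M (E n))
    (q u u' w : E n) : chartForm g e q (u + u') w = chartForm g e q u w + chartForm g e q u' w := by
  simp only [chartForm_eq_sum, PiLp.add_apply, add_mul, Finset.sum_add_distrib]

theorem chartForm_sub_left (g : Metric n M) (e : OpenPartialHomeomorph M (E n))
    (q u u' w : E n) : chartForm g e q (u - u') w = chartForm g e q u w - chartForm g e q u' w := by
  simp only [chartForm_eq_sum, PiLp.sub_apply, sub_mul, Finset.sum_sub_distrib]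

/-- Koszul's formula for `Γ(u, u)`, free of indices. -/
theorem chartForm_chrisVec (g : Metric n M) {e : OpenPartialHomeomorph M (E n)}
    (he : e ∈ charts n M) {q : E n} (hq : q ∈ e.target) (u w : E n) :
    chartForm g e q (chrisVec g e q u) w
      = dChartForm g e q u u w - (1 / 2) * dChartForm g e q w u u := by
  have h1 : chartForm g e q (chrisVec g e q u) w = ∑ m, ∑ i, ∑ j, w m * u i * u j *
      ∑ k, chartMatrix g e q m k * christoffel g e q k i j := by
    rw [chartForm_symm, chartForm_eq_sum]
    refine Finset.sum_congr rfl fun m _ => ?_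
    simp only [chrisVec, Finset.mul_sum, Finset.sum_mul]
    rw [Finset.sum_comm]
    refine Finset.sum_congr rfl fun i _ => ?_
    rw [Finset.sum_comm]
    exact Finset.sum_congr rfl fun j _ => Finset.sum_congr rfl fun k _ => by ring
  have h2 : ∀ (f : Fin n → Fin n → Fin n → ℝ),
      ∑ m, ∑ i, ∑ j, f m i j = ∑ i, ∑ m, ∑ j, f m i j := fun f => Finset.sum_comm
  have h3 : dChartForm g e q u u w
      = ∑ m, ∑ i, ∑ j, w m * u i * u j * dChartMatrix g e q i j m := by
    simp only [dChartForm, Finset.mul_sum]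
    calc _ = ∑ i, ∑ m, ∑ j, w m * u i * u j * dChartMatrix g e q j i m :=
          Finset.sum_congr rfl fun i _ => Finset.sum_congr rfl fun m _ =>
            Finset.sum_congr rfl fun j _ => by ring
      _ = ∑ m, ∑ i, ∑ j, w m * u i * u j * dChartMatrix g e q j i m := Finset.sum_comm
      _ = _ := Finset.sum_congr rfl fun m _ => by
          rw [Finset.sum_comm]
          exact Finset.sum_congr rfl fun i _ => Finset.sum_congr rfl fun j _ => by ring
  have h3' : dChartForm g e q u u w
      = ∑ m, ∑ i, ∑ j, w m * u i * u j * dChartMatrix g e q j i m := by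
    rw [h3]
    refine Finset.sum_congr rfl fun m _ => ?_
    rw [Finset.sum_comm]
    exact Finset.sum_congr rfl fun i _ => Finset.sum_congr rfl fun j _ => by ring
  have h4 : dChartForm g e q w u u
      = ∑ m, ∑ i, ∑ j, w m * u i * u j * dChartMatrix g e q m i j := by
    simp only [dChartForm, Finset.mul_sum]
    calc _ = ∑ i, ∑ m, ∑ j, w m * u i * u j * dChartMatrix g e q m i j := by
          refine Finset.sum_congr rfl fun i _ => ?_
          rw [Finset.sum_comm]
          exact Finset.sum_congr rfl fun m _ => Finset.sum_congr rfl fun j _ => by ring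
      _ = _ := Finset.sum_comm
  have h5 : dChartForm g e q u u w = (1 / 2) * dChartForm g e q u u w
      + (1 / 2) * dChartForm g e q u u w := by ring
  rw [h5]
  nth_rewrite 1 [h3]
  rw [h1, h3', h4]
  simp only [Finset.mul_sum, ← Finset.sum_add_distrib, ← Finset.sum_sub_distrib]
  refine Finset.sum_congr rfl fun m _ => Finset.sum_congr rfl fun i _ =>
    Finset.sum_congr rfl fun j _ => ?_
  rw [← Finset.mul_sum, sum_chartMatrix_mul_christoffel g he hq]
  ring

theorem hasDerivAt_chartMatrix (g : Metric n M) {e : OpenPartialHomeomorph M (E n)}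
    (he : e ∈ charts n M) {y : ℝ → E n} {y' : E n} {t : ℝ} (hy : HasDerivAt y y' t)
    (ht : y t ∈ e.target) (i j : Fin n) :
    HasDerivAt (fun s => chartMatrix g e (y s) i j)
      (∑ l, y' l * dChartMatrix g e (y t) l i j) t := by
  have h := ((contDiffAt_chartMatrix g he ht i j).differentiableAt
    (by norm_num)).hasFDerivAt.comp_hasDerivAt t hy
  refine h.congr_deriv ?_
  conv_lhs => rw [← sum_smul_stdVec y', map_sum]
  exact Finset.sum_congr rfl fun l _ => map_smul _ _ _

theorem hasDerivAt_coord {U : ℝ → E n} {U' : E n} {t : ℝ} (hU : HasDerivAt U U' t) (i : Fin n) :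
    HasDerivAt (fun s => U s i) (U' i) t :=
  (EuclideanSpace.proj i : E n →L[ℝ] ℝ).hasFDerivAt.comp_hasDerivAt t hU

theorem hasDerivAt_of_coord {U : ℝ → E n} {U' : E n} {t : ℝ}
    (hU : ∀ i, HasDerivAt (fun s => U s i) (U' i) t) : HasDerivAt U U' t := by
  have h : HasDerivAt (fun s => ∑ i, U s i • (stdVec i : E n)) (∑ i, U' i • stdVec i) t :=
    HasDerivAt.fun_sum fun i _ => (hU i).smul_const _
  simpa only [sum_smul_stdVec] using h

/-- The product rule for the scalar product of vector fields along a curve. -/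
theorem hasDerivAt_chartForm (g : Metric n M) {e : OpenPartialHomeomorph M (E n)}
    (he : e ∈ charts n M) {y U W : ℝ → E n} {y' U' W' : E n} {t : ℝ}
    (hy : HasDerivAt y y' t) (hU : HasDerivAt U U' t) (hW : HasDerivAt W W' t)
    (ht : y t ∈ e.target) :
    HasDerivAt (fun s => chartForm g e (y s) (U s) (W s))
      (chartForm g e (y t) U' (W t) + chartForm g e (y t) (U t) W'
        + dChartForm g e (y t) y' (U t) (W t)) t := by
  simp only [chartForm_eq_sum]
  have h := HasDerivAt.fun_sum (u := Finset.univ) fun i _ =>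
    HasDerivAt.fun_sum (u := Finset.univ) fun j _ =>
      ((hasDerivAt_coord hU i).mul (hasDerivAt_coord hW j)).mul
        (hasDerivAt_chartMatrix g he hy ht i j)
  refine h.congr_deriv ?_
  simp only [dChartForm, ← Finset.sum_add_distrib]
  exact Finset.sum_congr rfl fun i _ => Finset.sum_congr rfl fun j _ => by
    simp only [Pi.mul_apply]
    ring

theorem inner_eq_of_eq (g : Metric n M) {x y : M} (h : x = y) (v w : E n) :
    g.inner x v w = g.inner y v w := by
  subst h
  rfl

theorem chartForm_transition (g : Metric n M) {e e' : OpenPartialHomeomorph M (E n)}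
    (he : e ∈ charts n M) (he' : e' ∈ charts n M) {q : E n} (hq : q ∈ e.target)
    (hq' : e.symm q ∈ e'.source) (u w : E n) :
    chartForm g e q u w = chartForm g e' (e' (e.symm q)) (fderiv ℝ (e' ∘ e.symm) q u)
      (fderiv ℝ (e' ∘ e.symm) q w) := by
  have h := (mdifferentiable_of_mem_charts he').symm_comp_deriv hq'
  have h1 : ∀ u : E n, mfderiv 𝓘(ℝ, E n) 𝓘(ℝ, E n) e'.symm (e' (e.symm q))
      (fderiv ℝ (e' ∘ e.symm) q u) = mfderiv 𝓘(ℝ, E n) 𝓘(ℝ, E n) e.symm q u := by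
    intro u
    rw [fderiv_transition he he' hq hq']
    exact DFunLike.congr_fun h (mfderiv 𝓘(ℝ, E n) 𝓘(ℝ, E n) e.symm q u)
  unfold chartForm
  rw [h1, h1]
  exact (inner_eq_of_eq g (e'.left_inv hq') _ _).symm

theorem chartForm_left_cancel (g : Metric n M) {e : OpenPartialHomeomorph M (E n)}
    (he : e ∈ charts n M) {q : E n} (hq : q ∈ e.target) {u u' : E n}
    (h : ∀ w, chartForm g e q u w = chartForm g e q u' w) : u = u' := by
  by_contra hne
  have h0 : chartForm g e q (u - u') (u - u') = 0 := by
    rw [chartForm_sub_left, h, sub_self]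
  refine (g.pos _ (mfderiv 𝓘(ℝ, E n) 𝓘(ℝ, E n) e.symm q (u - u')) fun h1 => ?_).ne' h0
  exact sub_ne_zero.2 hne (mfderiv_symm_injective he hq (h1.trans (map_zero _).symm))

/-- The transformation law of the Christoffel symbols under the change of chart
`τ = e' ∘ e⁻¹`. -/
theorem chrisVec_transition (g : Metric n M) {e e' : OpenPartialHomeomorph M (E n)}
    (he : e ∈ charts n M) (he' : e' ∈ charts n M) {q : E n} (hq : q ∈ e.target)
    (hq' : e.symm q ∈ e'.source) (u : E n) :
    fderiv ℝ (e' ∘ e.symm) q (chrisVec g e q u)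
      = chrisVec g e' (e' (e.symm q)) (fderiv ℝ (e' ∘ e.symm) q u)
        + fderiv ℝ (fderiv ℝ (e' ∘ e.symm)) q u u := by
  set τ : E n → E n := e' ∘ e.symm with hτ
  have hq'' : τ q ∈ e'.target := e'.map_source hq'
  have hsm := contDiffAt_transition he he' hq hq'
  have hd : HasFDerivAt τ (fderiv ℝ τ q) q :=
    (hsm.differentiableAt (by simp)).hasFDerivAt
  have hdd : HasFDerivAt (fderiv ℝ τ) (fderiv ℝ (fderiv ℝ τ) q) q :=
    ((hsm.fderiv_right (m := 1) (by norm_cast)).differentiableAt one_ne_zero).hasFDerivAt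
  have hsymm : ∀ v w, fderiv ℝ (fderiv ℝ τ) q v w = fderiv ℝ (fderiv ℝ τ) q w v := by
    have h2 : IsSymmSndFDerivAt ℝ τ q := hsm.isSymmSndFDerivAt (by simpa using (by norm_cast : (2 : WithTop ℕ∞) ≤ ∞))
    exact fun v w => h2 v w
  have hev : ∀ᶠ x in 𝓝 q, x ∈ e.target ∧ e.symm x ∈ e'.source :=
    (show ∀ᶠ x in 𝓝 q, x ∈ e.target from e.open_target.mem_nhds hq).and
      ((e.continuousAt_symm hq).eventually (e'.open_source.mem_nhds hq'))
  -- differentiate the transformation law of the metric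
  have hD : ∀ v a b : E n, dChartForm g e q v a b
      = chartForm g e' (τ q) (fderiv ℝ (fderiv ℝ τ) q v a) (fderiv ℝ τ q b)
        + chartForm g e' (τ q) (fderiv ℝ τ q a) (fderiv ℝ (fderiv ℝ τ) q v b)
        + dChartForm g e' (τ q) (fderiv ℝ τ q v) (fderiv ℝ τ q a) (fderiv ℝ τ q b) := by
    intro v a b
    have hline : HasDerivAt (fun s : ℝ => q + s • v) v 0 := by
      simpa using ((hasDerivAt_id (0 : ℝ)).smul_const v).const_add q
    have h00 : q + (0 : ℝ) • v = q := by simp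
    have h1 := hasDerivAt_chartForm g he hline (hasDerivAt_const (0 : ℝ) a)
      (hasDerivAt_const (0 : ℝ) b) (by rwa [h00])
    have hy : HasDerivAt (fun s : ℝ => τ (q + s • v)) (fderiv ℝ τ q v) 0 := by
      refine HasFDerivAt.comp_hasDerivAt (f := fun s : ℝ => q + s • v) (l := τ) (0 : ℝ) ?_ hline
      rwa [h00]
    have hU : ∀ c : E n, HasDerivAt (fun s : ℝ => fderiv ℝ τ (q + s • v) c)
        (fderiv ℝ (fderiv ℝ τ) q v c) 0 := by
      intro c
      have h3 : HasDerivAt (fun s : ℝ => fderiv ℝ τ (q + s • v))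
          (fderiv ℝ (fderiv ℝ τ) q v) 0 := by
        refine HasFDerivAt.comp_hasDerivAt (f := fun s : ℝ => q + s • v) (l := fderiv ℝ τ)
          (0 : ℝ) ?_ hline
        rwa [h00]
      simpa using h3.clm_apply (hasDerivAt_const (0 : ℝ) c)
    have h2 := hasDerivAt_chartForm g he' hy (hU a) (hU b) (by rwa [h00])
    have hev' : ∀ᶠ s : ℝ in 𝓝 0, chartForm g e (q + s • v) a b
        = chartForm g e' (τ (q + s • v)) (fderiv ℝ τ (q + s • v) a)
          (fderiv ℝ τ (q + s • v) b) := by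
      have hc : Tendsto (fun s : ℝ => q + s • v) (𝓝 0) (𝓝 q) := by
        have := hline.continuousAt.tendsto
        rwa [h00] at this
      filter_upwards [hc.eventually hev] with s hs
      exact chartForm_transition g he he' hs.1 hs.2 a b
    have h4 := h1.unique (h2.congr_of_eventuallyEq hev')
    simp only [h00] at h4
    rw [← h4]
    have hz : ∀ w, chartForm g e q 0 w = 0 := fun w => by simp [chartForm_eq_sum]
    rw [hz, chartForm_symm, hz]
    ring
  refine chartForm_left_cancel g he' hq'' fun w' => ?_
  obtain ⟨w, rfl⟩ := fderiv_transition_surjective he he' hq hq' w'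
  have h1 := chartForm_chrisVec g he hq u w
  rw [chartForm_transition g he he' hq hq', hD, hD] at h1
  change chartForm g e' (τ q) _ _ = chartForm g e' (τ q) (chrisVec g e' (τ q) _ + _) _
  rw [chartForm_add_left, chartForm_chrisVec g he' hq'']
  rw [hsymm w u, chartForm_symm g e' (τ q) (fderiv ℝ (fderiv ℝ τ) q u w)] at h1
  change chartForm g e' (τ q) _ _ = _ at h1
  linear_combination h1

/-! ### Local existence of geodesics -/

theorem contDiffAt_christoffel (g : Metric n M) {e : OpenPartialHomeomorph M (E n)}
    (he : e ∈ charts n M) {q : E n} (hq : q ∈ e.target) (k i j : Fin n) :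
    ContDiffAt ℝ 1 (fun q => christoffel g e q k i j) q := by
  have hinv : ∀ k l, ContDiffAt ℝ 1 (fun q => (chartMatrix g e q)⁻¹ k l) q := by
    intro k l
    have h : open scoped Matrix.Norms.Operator in
        ContDiffAt ℝ 2 (fun q => (chartMatrix g e q)⁻¹) q :=
      contDiffAt_matrix_inv (contDiffAt_matrix_of_entries fun i j =>
        contDiffAt_chartMatrix g he hq i j) (det_chartMatrix_pos g he hq).ne'
    exact (contDiffAt_entry h k l).of_le (by norm_num)
  have hd : ∀ l i j, ContDiffAt ℝ 1 (fun q => dChartMatrix g e q l i j) q := by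
    intro l i j
    exact ((contDiffAt_chartMatrix g he hq i j).fderiv_right (m := 1)
      (by norm_num)).clm_apply contDiffAt_const
  unfold christoffel
  exact contDiffAt_const.mul (ContDiffAt.sum fun l _ =>
    (hinv k l).mul (((hd i j l).add (hd j i l)).sub (hd l i j)))

theorem contDiffAt_chrisVec (g : Metric n M) {e : OpenPartialHomeomorph M (E n)}
    (he : e ∈ charts n M) {q : E n} (hq : q ∈ e.target) (u : E n) :
    ContDiffAt ℝ 1 (fun w : E n × E n => chrisVec g e w.1 w.2) (q, u) := by
  have hp : ∀ i : Fin n, ContDiffAt ℝ 1 (fun w : E n × E n => w.2 i) (q, u) := fun i =>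
    ((EuclideanSpace.proj i : E n →L[ℝ] ℝ).contDiff.comp contDiff_snd).contDiffAt
  have h : ContDiffAt ℝ 1 (fun w : E n × E n => ∑ k, (∑ i, ∑ j,
      christoffel g e w.1 k i j * w.2 i * w.2 j) • (stdVec k : E n)) (q, u) := by
    refine ContDiffAt.sum fun k _ => ContDiffAt.smul_const ?_ _
    refine ContDiffAt.sum fun i _ => ContDiffAt.sum fun j _ => ?_
    exact (((contDiffAt_christoffel g he hq k i j).comp (q, u) contDiffAt_fst).mul (hp i)).mul
      (hp j)
  refine h.congr_of_eventuallyEq (Eventually.of_forall fun w => ?_)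
  exact (sum_smul_stdVec (chrisVec g e w.1 w.2)).symm

/-- A solution of the geodesic equation in one chart is a geodesic, that is, it solves the
equation in every chart. -/
theorem isGeodesicOn_of_chart (g : Metric n M) {e : OpenPartialHomeomorph M (E n)}
    (he : e ∈ charts n M) {x v : ℝ → E n} {J : Set ℝ} (hJ : IsOpen J)
    (hx : ∀ t ∈ J, x t ∈ e.target) (hxv : ∀ t ∈ J, HasDerivAt x (v t) t)
    (hv : ∀ t ∈ J, HasDerivAt v (-chrisVec g e (x t) (v t)) t) :
    IsGeodesicOn g (fun t => e.symm (x t)) J := by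
  refine ⟨fun t ht => ContinuousAt.continuousWithinAt
    ((e.continuousAt_symm (hx t ht)).comp (hxv t ht).continuousAt), fun t ht e' he' hs => ?_⟩
  set τ : E n → E n := e' ∘ e.symm with hτ
  have hder : ∀ s ∈ J, e.symm (x s) ∈ e'.source →
      HasDerivAt (fun s => e' (e.symm (x s))) (fderiv ℝ τ (x s) (v s)) s := by
    intro s hsJ hse
    exact ((contDiffAt_transition he he' (hx s hsJ) hse).differentiableAt
      (by simp)).hasFDerivAt.comp_hasDerivAt s (hxv s hsJ)
  refine ⟨(hder t ht hs).differentiableAt, fun k => ?_⟩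
  have hev : ∀ᶠ s in 𝓝 t, deriv (fun r => e' (e.symm (x r))) s = fderiv ℝ τ (x s) (v s) := by
    have h1 : ∀ᶠ s in 𝓝 t, e.symm (x s) ∈ e'.source :=
      ((e.continuousAt_symm (hx t ht)).comp (hxv t ht).continuousAt).eventually
        (e'.open_source.mem_nhds hs)
    filter_upwards [h1, hJ.mem_nhds ht] with s hs1 hs2
    exact (hder s hs2 hs1).deriv
  have hsm := contDiffAt_transition he he' (hx t ht) hs
  have hdd : HasFDerivAt (fderiv ℝ τ) (fderiv ℝ (fderiv ℝ τ) (x t)) (x t) :=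
    ((hsm.fderiv_right (m := 1) (by norm_cast)).differentiableAt one_ne_zero).hasFDerivAt
  have h2 : HasDerivAt (fun s => fderiv ℝ τ (x s) (v s))
      (-chrisVec g e' (e' (e.symm (x t))) (fderiv ℝ τ (x t) (v t))) t := by
    refine ((hdd.comp_hasDerivAt t (hxv t ht)).clm_apply (hv t ht)).congr_deriv ?_
    change fderiv ℝ (fderiv ℝ τ) (x t) (v t) (v t)
      + fderiv ℝ τ (x t) (-chrisVec g e (x t) (v t)) = _
    rw [map_neg, chrisVec_transition g he he' (hx t ht) hs]
    abel
  have h3 := h2.congr_of_eventuallyEq hev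
  have h4 := hasDerivAt_coord h3 k
  have h5 : deriv (fun r => e' (e.symm (x r))) t = fderiv ℝ τ (x t) (v t) := hev.self_of_nhds
  rw [h5]
  exact h4

theorem exists_geodesic (g : Metric n M) {e : OpenPartialHomeomorph M (E n)}
    (he : e ∈ charts n M) {q : E n} (hq : q ∈ e.target) (u : E n) :
    ∃ (J : Set ℝ) (γ : ℝ → M), IsOpenInterval J ∧ (0 : ℝ) ∈ J ∧ IsGeodesicOn g γ J ∧
      γ 0 = e.symm q ∧ deriv (fun s => e (γ s)) 0 = u := by
  have hf : ContDiffAt ℝ 1 (fun w : E n × E n => (w.2, -chrisVec g e w.1 w.2)) (q, u) :=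
    contDiffAt_snd.prodMk (contDiffAt_chrisVec g he hq u).neg
  obtain ⟨α, hα0, ε, hε, hα⟩ :=
    hf.exists_forall_mem_closedBall_exists_eq_forall_mem_Ioo_hasDerivAt₀ 0
  simp only [zero_sub, zero_add] at hα
  have h0 : (0 : ℝ) ∈ Ioo (-ε) ε := ⟨by linarith, hε⟩
  have htar : ∀ᶠ s in 𝓝 (0 : ℝ), (α s).1 ∈ e.target := by
    have hc : ContinuousAt (fun s => (α s).1) 0 := (hα 0 h0).continuousAt.fst
    refine hc.eventually (e.open_target.mem_nhds ?_)
    simpa only [hα0] using hq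
  obtain ⟨δ, hδ, hδt⟩ := Metric.eventually_nhds_iff.1 htar
  set m := min ε δ with hm
  have hmpos : 0 < m := lt_min hε hδ
  have hsub : ∀ s ∈ Ioo (-m) m, s ∈ Ioo (-ε) ε := fun s hs =>
    ⟨lt_of_le_of_lt (neg_le_neg (min_le_left _ _)) hs.1, hs.2.trans_le (min_le_left _ _)⟩
  have ht : ∀ s ∈ Ioo (-m) m, (α s).1 ∈ e.target := fun s hs => by
    refine hδt ?_
    rw [Real.dist_eq, sub_zero, abs_lt]
    exact ⟨lt_of_le_of_lt (neg_le_neg (min_le_right _ _)) hs.1, hs.2.trans_le (min_le_right _ _)⟩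
  have hx : ∀ s ∈ Ioo (-m) m, HasDerivAt (fun s => (α s).1) (α s).2 s := fun s hs =>
    (hα s (hsub s hs)).fst
  have hv : ∀ s ∈ Ioo (-m) m, HasDerivAt (fun s => (α s).2) (-chrisVec g e (α s).1 (α s).2) s :=
    fun s hs => (hα s (hsub s hs)).snd
  have hm0 : (0 : ℝ) ∈ Ioo (-m) m := ⟨by linarith, hmpos⟩
  refine ⟨Ioo (-m) m, fun s => e.symm (α s).1, ⟨isOpen_Ioo, ordConnected_Ioo⟩, hm0,
    isGeodesicOn_of_chart g he isOpen_Ioo ht hx hv, by simp only [hα0], ?_⟩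
  have hev : (fun s => e (e.symm (α s).1)) =ᶠ[𝓝 0] fun s => (α s).1 := by
    filter_upwards [htar] with s hs using e.right_inv hs
  rw [hev.deriv_eq, (hx 0 hm0).deriv, hα0]

/-! ### The difference of the connections of geodesically equivalent metrics -/

/-- If a geodesic of `g` with velocity `u` can be reparametrized to a geodesic of `g'`, then
`Γ'(u, u) - Γ(u, u)` is proportional to `u`. -/
theorem exists_chrisVec_sub_eq_smul {g g' : Metric n M} (h : GeodesicsInclude g g')
    {e : OpenPartialHomeomorph M (E n)} (he : e ∈ charts n M) {q : E n} (hq : q ∈ e.target)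
    (u : E n) : ∃ c : ℝ, chrisVec g' e q u - chrisVec g e q u = c • u := by
  obtain ⟨J, γ, hJ, h0J, hγ, hγ0, hγu⟩ := exists_geodesic g he hq u
  obtain ⟨J', φ, ⟨hJ', hφ2, hφ0, hbij⟩, hγφ⟩ := h J γ hJ hγ
  obtain ⟨s₀, hs₀, hφs₀⟩ := hbij.surjOn h0J
  have hsrc : γ 0 ∈ e.source := by rw [hγ0]; exact e.map_target hq
  have hq0 : e (γ 0) = q := by rw [hγ0, e.right_inv hq]
  have hφat : ∀ s ∈ J', ContDiffAt ℝ 2 φ s := fun s hs =>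
    hφ2.contDiffAt (hJ'.1.mem_nhds hs)
  set c : ℝ → E n := fun r => e (γ r) with hc
  obtain ⟨-, hγ2⟩ := hγ.2 0 h0J e he hsrc
  have hc2 : HasDerivAt (deriv c) (-chrisVec g e q u) 0 := by
    refine hasDerivAt_of_coord fun k => ?_
    have := hγ2 k
    rw [hγu, hq0] at this
    exact this
  obtain ⟨-, hγφ2⟩ := hγφ.2 s₀ hs₀ e he (by simpa [hφs₀] using hsrc)
  have hcφ : ∀ᶠ s in 𝓝 s₀, deriv (fun r => e ((γ ∘ φ) r)) s = deriv φ s • deriv c (φ s) := by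
    have h1 : ∀ᶠ r in 𝓝 (0 : ℝ), γ r ∈ e.source :=
      (hγ.1.continuousAt (hJ.1.mem_nhds h0J)).eventually (e.open_source.mem_nhds hsrc)
    have h2 : Tendsto φ (𝓝 s₀) (𝓝 0) := by
      have := (hφat s₀ hs₀).continuousAt.tendsto
      rwa [hφs₀] at this
    filter_upwards [h2.eventually h1, hJ'.1.mem_nhds hs₀] with s hs1 hs2
    have hd : DifferentiableAt ℝ c (φ s) := (hγ.2 (φ s) (hbij.mapsTo hs2) e he hs1).1
    have hφd : DifferentiableAt ℝ φ s := (hφat s hs2).differentiableAt (by norm_num)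
    exact (hd.hasDerivAt.scomp s hφd.hasDerivAt).deriv
  have hφ' : HasDerivAt (deriv φ) (deriv (deriv φ) s₀) s₀ := by
    have h1 : ContDiffAt ℝ 1 (fderiv ℝ φ) s₀ := (hφat s₀ hs₀).fderiv_right (by norm_num)
    have h2 : DifferentiableAt ℝ (fun s => fderiv ℝ φ s 1) s₀ :=
      (h1.differentiableAt one_ne_zero).clm_apply (differentiableAt_const _)
    exact h2.hasDerivAt
  have hφ1 : HasDerivAt φ (deriv φ s₀) s₀ :=
    ((hφat s₀ hs₀).differentiableAt (by norm_num)).hasDerivAt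
  have hcomp : HasDerivAt (fun s => deriv φ s • deriv c (φ s))
      (deriv φ s₀ • (deriv φ s₀ • -chrisVec g e q u) + deriv (deriv φ) s₀ • u) s₀ := by
    have h1 : HasDerivAt (fun s => deriv c (φ s)) (deriv φ s₀ • -chrisVec g e q u) s₀ := by
      refine HasDerivAt.scomp (g₁ := deriv c) (h := φ) s₀ ?_ hφ1
      rwa [hφs₀]
    have h2 := hφ'.fun_smul h1
    rw [hφs₀, show deriv c 0 = u from hγu] at h2
    exact h2
  have hcomp2 := hcomp.congr_of_eventuallyEq hcφ
  have hvel : deriv (fun r => e ((γ ∘ φ) r)) s₀ = deriv φ s₀ • u := by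
    rw [hcφ.self_of_nhds, hφs₀, show deriv c 0 = u from hγu]
  have hpt : e ((γ ∘ φ) s₀) = q := by simpa [hφs₀] using hq0
  have hk : ∀ k, (deriv φ s₀ • (deriv φ s₀ • -chrisVec g e q u) + deriv (deriv φ) s₀ • u) k
      = -(deriv φ s₀ ^ 2 * chrisVec g' e q u k) := by
    intro k
    have h1 := (hasDerivAt_coord hcomp2 k).unique (hγφ2 k)
    rw [hvel, hpt] at h1
    rw [h1]
    simp only [chrisVec, PiLp.smul_apply, smul_eq_mul, Finset.mul_sum]
    exact congrArg _ (Finset.sum_congr rfl fun i _ => Finset.sum_congr rfl fun j _ => by ring)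
  have hne := hφ0 s₀ hs₀
  refine ⟨-(deriv (deriv φ) s₀ / deriv φ s₀ ^ 2), ?_⟩
  ext k
  have h1 := hk k
  simp only [PiLp.add_apply, PiLp.smul_apply, PiLp.neg_apply, PiLp.sub_apply, smul_eq_mul] at h1 ⊢
  field_simp
  linear_combination h1

/-- A symmetric bilinear map `T` for which every vector `u` is proportional to `T(u, u)` is of the
form `T(u, v) = φ(u) v + φ(v) u`. -/
theorem exists_covector_of_proportional (T : Fin n → Fin n → Fin n → ℝ)
    (hT : ∀ k i j, T k i j = T k j i)
    (h : ∀ u : Fin n → ℝ, ∃ c : ℝ, ∀ k, ∑ i, ∑ j, T k i j * u i * u j = c * u k) :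
    ∃ φ : Fin n → ℝ, ∀ k i j,
      T k i j = (if k = i then φ j else 0) + (if k = j then φ i else 0) := by
  have hdiag : ∀ i, ∃ c : ℝ, ∀ k, T k i i = c * (if k = i then 1 else 0) := by
    intro i
    obtain ⟨c, hc⟩ := h (Pi.single i 1)
    refine ⟨c, fun k => ?_⟩
    have := hc k
    simpa [Pi.single_apply] using this
  choose lam hlam using hdiag
  have hpair : ∀ (i j : Fin n) (x : ℝ), ∃ c : ℝ, ∀ k,
      T k i i + 2 * x * T k i j + x ^ 2 * T k j j
        = c * ((if k = i then 1 else 0) + x * (if k = j then 1 else 0)) := by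
    intro i j x
    obtain ⟨c, hc⟩ := h (Pi.single i 1 + x • Pi.single j 1)
    refine ⟨c, fun k => ?_⟩
    have := hc k
    simp only [Pi.add_apply, Pi.smul_apply, smul_eq_mul, Pi.single_apply, mul_add, add_mul,
      Finset.sum_add_distrib] at this
    simp at this
    rw [hT k j i] at this
    simp only [mul_add]
    simp
    linear_combination this
  refine ⟨fun i => lam i / 2, fun k i j => ?_⟩
  by_cases hij : i = j
  · subst hij
    rw [hlam i k]
    split_ifs <;> ring
  -- polarization: compare `u = e_i + e_j` with `u = e_i - e_j`
  obtain ⟨c, hc⟩ := hpair i j 1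
  obtain ⟨d, hd⟩ := hpair i j (-1)
  have hi1 := hc i
  have hi2 := hd i
  have hj1 := hc j
  have hj2 := hd j
  have hk1 := hc k
  have hk2 := hd k
  rw [hlam i, hlam j] at hi1 hi2 hj1 hj2 hk1 hk2
  simp only [if_true, if_neg hij, if_neg (Ne.symm hij)] at hi1 hi2 hj1 hj2
  have e1 : c + d = 2 * lam i := by linarith
  have e2 : c - d = 2 * lam j := by linarith
  split_ifs at hk1 hk2 ⊢ <;> linarith

/-- Weyl's characterization: the Christoffel symbols of geodesically equivalent metrics differ by
`δ^k_i φ_j + δ^k_j φ_i`. -/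
theorem exists_christoffel_eq {g g' : Metric n M} (h : GeodesicsInclude g g')
    {e : OpenPartialHomeomorph M (E n)} (he : e ∈ charts n M) {q : E n} (hq : q ∈ e.target) :
    ∃ φ : Fin n → ℝ, ∀ k i j, christoffel g' e q k i j = christoffel g e q k i j
      + ((if k = i then φ j else 0) + (if k = j then φ i else 0)) := by
  obtain ⟨φ, hφ⟩ := exists_covector_of_proportional
    (fun k i j => christoffel g' e q k i j - christoffel g e q k i j)
    (fun k i j => by rw [christoffel_symm g', christoffel_symm g]) (fun u => by
      obtain ⟨c, hc⟩ := exists_chrisVec_sub_eq_smul h he hq (WithLp.toLp 2 u)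
      refine ⟨c, fun k => ?_⟩
      have := congrArg (fun z : E n => z k) hc
      simp only [PiLp.sub_apply, PiLp.smul_apply, smul_eq_mul, chrisVec] at this
      rw [← this, ← Finset.sum_sub_distrib]
      refine Finset.sum_congr rfl fun i _ => ?_
      rw [← Finset.sum_sub_distrib]
      exact Finset.sum_congr rfl fun j _ => by ring)
  exact ⟨φ, fun k i j => by rw [← hφ k i j]; ring⟩

end Connection

/-! ### The integrals in involution -/

section Involution

variable {n : ℕ} {M : Type*} [TopologicalSpace M] [ChartedSpace (E n) M]
  [IsManifold 𝓘(ℝ, E n) ∞ M]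

/-- The connection matrix `(Γ_i)^k_j = Γ^k_{ij}` in direction `∂/∂q^i`. -/
noncomputable def connMatrix (g : Metric n M) (e : OpenPartialHomeomorph M (E n)) (q : E n)
    (i : Fin n) : Matrix (Fin n) (Fin n) ℝ :=
  Matrix.of fun k j => christoffel g e q k i j

theorem coe_stdVec (i : Fin n) : ⇑(stdVec i : E n) = Pi.single i 1 := rfl

theorem hasDerivAt_add_smul (q v : E n) : HasDerivAt (fun s : ℝ => q + s • v) v 0 := by
  simpa using ((hasDerivAt_id (0 : ℝ)).smul_const v).const_add q

open scoped Matrix.Norms.Operator in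
/-- The metric is parallel for its Levi-Civita connection. -/
theorem hasDerivAt_chartMatrix_line (g : Metric n M) {e : OpenPartialHomeomorph M (E n)}
    (he : e ∈ charts n M) {q : E n} (hq : q ∈ e.target) (i : Fin n) :
    HasDerivAt (fun s : ℝ => chartMatrix g e (q + s • stdVec i))
      (chartMatrix g e q * connMatrix g e q i
        + (connMatrix g e q i)ᵀ * chartMatrix g e q) 0 := by
  have h00 : q + (0 : ℝ) • (stdVec i : E n) = q := by simp
  refine hasDerivAt_matrix_of_entries fun r c => ?_
  refine (hasDerivAt_chartMatrix g he (hasDerivAt_add_smul q (stdVec i)) (by rwa [h00])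
    r c).congr_deriv ?_
  have h1 := sum_chartMatrix_mul_christoffel g he hq r i c
  have h2 := sum_chartMatrix_mul_christoffel g he hq c i r
  have h3 : (chartMatrix g e q * connMatrix g e q i) r c
      = ∑ k, chartMatrix g e q r k * christoffel g e q k i c := rfl
  have h4 : ((connMatrix g e q i)ᵀ * chartMatrix g e q) r c
      = ∑ k, chartMatrix g e q c k * christoffel g e q k i r := by
    rw [Matrix.mul_apply]
    refine Finset.sum_congr rfl fun k _ => ?_
    rw [chartMatrix_symm g e q c k, mul_comm]
    rfl
  rw [Matrix.add_apply, h3, h4, h1, h2, h00, coe_stdVec, dChartMatrix_symm g e q i c r]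
  simp [Pi.single_apply]
  ring

theorem connMatrix_eq_projChange {g g' : Metric n M} {e : OpenPartialHomeomorph M (E n)} {q : E n}
    {φ : Fin n → ℝ} (hφ : ∀ k i j, christoffel g' e q k i j = christoffel g e q k i j
      + ((if k = i then φ j else 0) + (if k = j then φ i else 0))) (i : Fin n) :
    connMatrix g' e q i = projChange (connMatrix g e q i) φ (stdVec i : E n) := by
  ext k j
  rw [projChange, coe_stdVec, Matrix.add_apply, Matrix.add_apply, Matrix.smul_apply,
    Matrix.vecMulVec_apply, dotProduct_single_one, connMatrix, Matrix.of_apply, hφ, connMatrix,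
    Matrix.of_apply, Pi.single_apply, Matrix.one_apply, smul_eq_mul]
  split_ifs <;> ring

/-- The Poisson bracket of two functions of the canonical coordinates. -/
noncomputable def coordBracket (F K : E n × E n → ℝ) (w : E n × E n) : ℝ :=
  ∑ i, (dq F w i * dp K w i - dp F w i * dq K w i)

theorem dq_eq_of_hasDerivAt {F : E n × E n → ℝ} {q p : E n} (hF : DifferentiableAt ℝ F (q, p))
    {i : Fin n} {c : ℝ} (h : HasDerivAt (fun s : ℝ => F (q + s • stdVec i, p)) c 0) :
    dq F (q, p) i = c := by
  have hl : HasDerivAt (fun s : ℝ => (q + s • (stdVec i : E n), p)) (stdVec i, 0) 0 :=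
    (hasDerivAt_add_smul q (stdVec i)).prodMk (hasDerivAt_const _ _)
  have h00 : (q + (0 : ℝ) • (stdVec i : E n), p) = (q, p) := by simp
  refine HasDerivAt.unique (HasFDerivAt.comp_hasDerivAt
    (f := fun s : ℝ => (q + s • (stdVec i : E n), p)) (l := F) (0 : ℝ) ?_ hl) h
  rw [h00]
  exact hF.hasFDerivAt

theorem dp_eq_of_hasDerivAt {F : E n × E n → ℝ} {q p : E n} (hF : DifferentiableAt ℝ F (q, p))
    {i : Fin n} {c : ℝ} (h : HasDerivAt (fun s : ℝ => F (q, p + s • stdVec i)) c 0) :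
    dp F (q, p) i = c := by
  have hl : HasDerivAt (fun s : ℝ => (q, p + s • (stdVec i : E n))) (0, stdVec i) 0 :=
    (hasDerivAt_const _ _).prodMk (hasDerivAt_add_smul p (stdVec i))
  have h00 : (q, p + (0 : ℝ) • (stdVec i : E n)) = (q, p) := by simp
  refine HasDerivAt.unique (HasFDerivAt.comp_hasDerivAt
    (f := fun s : ℝ => (q, p + s • (stdVec i : E n))) (l := F) (0 : ℝ) ?_ hl) h
  rw [h00]
  exact hF.hasFDerivAt

/-- The generating functions of geodesically equivalent metrics Poisson-commute. -/
theorem coordBracket_genCoords {g g' : Metric n M} (h : GeodesicsInclude g g')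
    {e : OpenPartialHomeomorph M (E n)} (he : e ∈ charts n M) {q : E n} (hq : q ∈ e.target)
    (p : E n) {t s : ℝ} (ht : (pencil (chartMatrix g e q) (chartMatrix g' e q) t).det ≠ 0)
    (hs : (pencil (chartMatrix g e q) (chartMatrix g' e q) s).det ≠ 0) :
    coordBracket (genCoords g g' e t) (genCoords g g' e s) (q, p) = 0 := by
  obtain ⟨φ, hφ⟩ := exists_christoffel_eq h he hq
  have hA := transpose_chartMatrix g e q
  have hB := transpose_chartMatrix g' e q
  have ha0 := det_chartMatrix_pos g he hq
  have hb0 := det_chartMatrix_pos g' he hq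
  have hline0 : ∀ i : Fin n, q + (0 : ℝ) • (stdVec i : E n) = q := fun i => by simp
  have hdq : ∀ {x : ℝ}, (pencil (chartMatrix g e q) (chartMatrix g' e q) x).det ≠ 0 → ∀ i,
      dq (genCoords g g' e x) (q, p) i
        = (pencil (chartMatrix g e q) (chartMatrix g' e q) x).det * (chartMatrix g e q).det
          * (2 * x * ((((pencil (chartMatrix g e q) (chartMatrix g' e q) x)⁻¹ *ᵥ
                ((chartMatrix g e q)⁻¹ *ᵥ ⇑p)) i)
              * (-(sigma (chartMatrix g e q) (chartMatrix g' e q) *ᵥ φ) ⬝ᵥ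
                ((pencil (chartMatrix g e q) (chartMatrix g' e q) x)⁻¹ *ᵥ
                  ((chartMatrix g e q)⁻¹ *ᵥ ⇑p)))
            - (((pencil (chartMatrix g e q) (chartMatrix g' e q) x)⁻¹ *ᵥ
                -(sigma (chartMatrix g e q) (chartMatrix g' e q) *ᵥ φ)) i)
              * (((chartMatrix g e q)⁻¹ *ᵥ ((pencil (chartMatrix g e q)
                (chartMatrix g' e q) x)⁻¹ *ᵥ ((chartMatrix g e q)⁻¹ *ᵥ ⇑p))) ⬝ᵥ ⇑p)))
          - 2 * ((pencil (chartMatrix g e q) (chartMatrix g' e q) x).det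
              * (chartMatrix g e q).det)
            * ((connMatrix g e q i *ᵥ ((chartMatrix g e q)⁻¹ *ᵥ ((pencil (chartMatrix g e q)
                (chartMatrix g' e q) x)⁻¹ *ᵥ ((chartMatrix g e q)⁻¹ *ᵥ ⇑p)))) ⬝ᵥ ⇑p) := by
    intro x hx i
    refine dq_eq_of_hasDerivAt
      ((contDiffAt_genCoords g g' he hq p hx).differentiableAt (by norm_num)) ?_
    have h1 := hasDerivAt_chartMatrix_line g he hq i
    have h2 := hasDerivAt_chartMatrix_line g' he hq i
    rw [connMatrix_eq_projChange hφ i] at h2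
    have h3 := hasDerivAt_genFun (a := fun s : ℝ => chartMatrix g e (q + s • stdVec i))
      (b := fun s : ℝ => chartMatrix g' e (q + s • stdVec i)) (Γ := connMatrix g e q i) (φ := φ)
      (X := (stdVec i : E n)) (t := x) (by simpa only [hline0] using h1)
      (by simpa only [hline0] using h2) (by simpa only [hline0] using ha0)
      (by simpa only [hline0] using hb0) (by simpa only [hline0] using hA)
      (by simpa only [hline0] using hB) (by simpa only [hline0] using hx) p rfl rfl rfl rfl
    simp only [hline0, coe_stdVec, dotProduct_single_one] at h3
    exact h3
  have hdp : ∀ {x : ℝ}, (pencil (chartMatrix g e q) (chartMatrix g' e q) x).det ≠ 0 → ∀ i,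
      dp (genCoords g g' e x) (q, p) i
        = 2 * ((pencil (chartMatrix g e q) (chartMatrix g' e q) x).det * (chartMatrix g e q).det)
          * ((chartMatrix g e q)⁻¹ *ᵥ ((pencil (chartMatrix g e q) (chartMatrix g' e q) x)⁻¹ *ᵥ
            ((chartMatrix g e q)⁻¹ *ᵥ ⇑p))) i := by
    intro x hx i
    refine dp_eq_of_hasDerivAt
      ((contDiffAt_genCoords g g' he hq p hx).differentiableAt (by norm_num)) ?_
    have h3 := hasDerivAt_genFun_momentum (chartMatrix g e q) (chartMatrix g' e q) hA hB x p
      (stdVec i : E n)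
    simp only [coe_stdVec, dotProduct_single_one] at h3
    exact h3
  unfold coordBracket
  simp only [hdq ht, hdq hs, hdp ht, hdp hs]
  exact sum_bracket_eq_zero _ _ hA hB ha0.ne' ht hs p _ (connMatrix g e q)
    (fun i j k => christoffel_symm g e q k i j) _ _ rfl rfl rfl rfl

theorem poissonCommute_integralI {g g' : Metric n M} (h : GeodesicsInclude g g') {k l : ℕ}
    (hk : k < n) (hl : l < n) : PoissonCommute (integralI g g' k) (integralI g g' l) := by
  intro e he q hq p
  obtain ⟨v, hv, hc⟩ := exists_nodes g g' he hq
  obtain ⟨c, hc1⟩ := hc k hk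
  obtain ⟨d, hd1⟩ := hc l hl
  have hdiff : ∀ j, DifferentiableAt ℝ (genCoords g g' e (v j)) (q, p) := fun j =>
    (contDiffAt_genCoords g g' he hq p (hv j)).differentiableAt (by norm_num)
  have hf : ∀ (k : ℕ) (c : Fin n → ℝ), inCoords e (integralI g g' k) =ᶠ[𝓝 (q, p)]
      (fun w => ∑ j, c j * genCoords g g' e (v j) w) → ∀ z,
      fderiv ℝ (inCoords e (integralI g g' k)) (q, p) z
        = ∑ j, c j * fderiv ℝ (genCoords g g' e (v j)) (q, p) z := by
    intro k c hc z
    rw [hc.fderiv_eq, fderiv_fun_sum fun j _ => (hdiff j).const_mul (c j), sum_apply]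
    refine Finset.sum_congr rfl fun j _ => ?_
    rw [fderiv_const_mul (hdiff j)]
    rfl
  have hexp : poissonBracket e (integralI g g' k) (integralI g g' l) (q, p)
      = ∑ j, ∑ m, c j * d m *
        coordBracket (genCoords g g' e (v j)) (genCoords g g' e (v m)) (q, p) := by
    unfold poissonBracket coordBracket
    simp only [dq, dp, hf k c (hc1 p), hf l d (hd1 p)]
    have hsum : ∀ (x y : Fin n → Fin n → ℝ), ∑ i, (∑ j, c j * x i j) * (∑ m, d m * y i m)
        = ∑ j, ∑ m, c j * d m * ∑ i, x i j * y i m := by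
      intro x y
      rw [Finset.sum_congr rfl fun i _ => Finset.sum_mul_sum _ _ _ _, Finset.sum_comm]
      refine Finset.sum_congr rfl fun j _ => ?_
      rw [Finset.sum_comm]
      refine Finset.sum_congr rfl fun m _ => ?_
      rw [Finset.mul_sum]
      exact Finset.sum_congr rfl fun i _ => by ring
    simp only [Finset.sum_sub_distrib, mul_sub]
    rw [hsum fun i j => fderiv ℝ (genCoords g g' e (v j)) (q, p) (stdVec i, 0),
      hsum fun i j => fderiv ℝ (genCoords g g' e (v j)) (q, p) (0, stdVec i)]
  rw [hexp]
  refine Finset.sum_eq_zero fun j _ => Finset.sum_eq_zero fun m _ => ?_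
  rw [coordBracket_genCoords h he hq p (hv j) (hv m), mul_zero]

/-- Since `H = -I_{n-1} / 2`, the integrals commute with the Hamiltonian. -/
theorem poissonCommute_hamiltonian {g g' : Metric n M} (h : GeodesicsInclude g g') {k : ℕ}
    (hk : k < n) : PoissonCommute (integralI g g' k) (hamiltonian g) := by
  intro e he q hq p
  have hl : n - 1 < n := by omega
  have hH : inCoords e (hamiltonian g)
      = fun w => (-1 / 2) * inCoords e (integralI g g' (n - 1)) w := by
    funext w
    rw [inCoords, inCoords, integralI_last g g' (by omega)]
    ring
  have hd : DifferentiableAt ℝ (inCoords e (integralI g g' (n - 1))) (q, p) :=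
    ((isC2_integralI g g' hl e he).contDiffAt
      ((e.open_target.prod isOpen_univ).mem_nhds ⟨hq, mem_univ p⟩)).differentiableAt (by norm_num)
  have hf : ∀ z, fderiv ℝ (inCoords e (hamiltonian g)) (q, p) z
      = (-1 / 2) * fderiv ℝ (inCoords e (integralI g g' (n - 1))) (q, p) z := by
    intro z
    rw [hH, fderiv_const_mul hd]
    rfl
  have h1 := poissonCommute_integralI h hk hl e he q hq p
  have h2 : poissonBracket e (integralI g g' k) (hamiltonian g) (q, p)
      = (-1 / 2) * poissonBracket e (integralI g g' k) (integralI g g' (n - 1)) (q, p) := by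
    unfold poissonBracket dq dp
    simp only [hf, Finset.mul_sum]
    exact Finset.sum_congr rfl fun i _ => by ring
  rw [h2, h1, mul_zero]

/-! ### Constancy along Hamiltonian orbits -/

/-- A function of class `C²` which Poisson-commutes with `H` is constant along the orbits
of `H`. -/
theorem eq_of_isHamiltonianOrbit {F H : Cotangent n M → ℝ} (hF : IsC2 F)
    (hFH : PoissonCommute F H) {J : Set ℝ} {z : ℝ → Cotangent n M} (hJ : IsOpenInterval J)
    (hz : IsHamiltonianOrbit H z J) {s t : ℝ} (hs : s ∈ J) (ht : t ∈ J) : F (z s) = F (z t) := by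
  have hder : ∀ t ∈ J, HasDerivAt (fun s => F (z s)) 0 t := by
    intro t ht
    set e := chartAt (E n) (z t).1 with hedef
    have he : e ∈ charts n M := IsManifold.chart_mem_maximalAtlas _
    have hsrc : (z t).1 ∈ e.source := mem_chart_source _ _
    have hev : ∀ᶠ s in 𝓝 t, (z s).1 ∈ e.source :=
      (hz.1.continuousAt (hJ.1.mem_nhds ht)).eventually (e.open_source.mem_nhds hsrc)
    have hw := hz.2 t ht e he hsrc
    set w := toCanonical e (z t) with hwdef
    have h1 : HasDerivAt (fun s => (toCanonical e (z s)).1)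
        (WithLp.toLp 2 fun i => dp (inCoords e H) w i) t :=
      hasDerivAt_of_coord fun i => (hw i).1
    have h2 : HasDerivAt (fun s => (toCanonical e (z s)).2)
        (WithLp.toLp 2 fun i => -dq (inCoords e H) w i) t :=
      hasDerivAt_of_coord fun i => (hw i).2
    have hq : w.1 ∈ e.target := e.map_source hsrc
    have hd : DifferentiableAt ℝ (inCoords e F) w :=
      ((hF e he).contDiffAt ((e.open_target.prod isOpen_univ).mem_nhds
        ⟨hq, mem_univ w.2⟩)).differentiableAt (by norm_num)
    have h3 := HasFDerivAt.comp_hasDerivAt (f := fun s => toCanonical e (z s))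
      (l := inCoords e F) t hd.hasFDerivAt (h1.prodMk h2)
    have hsplit : ∀ a b : E n, fderiv ℝ (inCoords e F) w (a, b)
        = ∑ i, (a i * dq (inCoords e F) w i + b i * dp (inCoords e F) w i) := by
      intro a b
      have e1 : (a, b) = ∑ i, (a i • ((stdVec i : E n), (0 : E n))
          + b i • ((0 : E n), (stdVec i : E n))) := by
        have e2 : ∀ i, a i • ((stdVec i : E n), (0 : E n)) + b i • ((0 : E n), (stdVec i : E n))
            = (a i • stdVec i, b i • stdVec i) := fun i => by simp
        rw [Finset.sum_congr rfl fun i _ => e2 i, Prod.ext_iff, Prod.fst_sum, Prod.snd_sum]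
        exact ⟨(sum_smul_stdVec a).symm, (sum_smul_stdVec b).symm⟩
      rw [e1, map_sum]
      refine Finset.sum_congr rfl fun i _ => ?_
      rw [map_add, map_smul, map_smul]
      rfl
    have h4 := hFH e he w.1 hq w.2
    have h5 : HasDerivAt (fun s => inCoords e F (toCanonical e (z s))) 0 t := by
      refine h3.congr_deriv ?_
      rw [hsplit, ← h4]
      unfold poissonBracket
      exact Finset.sum_congr rfl fun i _ => by ring
    refine h5.congr_of_eventuallyEq ?_
    filter_upwards [hev] with r hr
    rw [inCoords, ofCanonical_toCanonical he hr]
  have hpre : IsPreconnected J := hJ.2.isPreconnected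
  exact hJ.1.is_const_of_deriv_eq_zero hpre
    (fun r hr => (hder r hr).differentiableAt.differentiableWithinAt)
    (fun r hr => (hder r hr).deriv) hs ht

end Involution

end GeodEquiv

theorem theorem1 {n : ℕ} {M : Type*} [TopologicalSpace M]
    [ChartedSpace (GeodEquiv.E n) M] [IsManifold 𝓘(ℝ, GeodEquiv.E n) ∞ M]
    (g g' : GeodEquiv.Metric n M) (h : GeodEquiv.GeodesicallyEquivalent g g') :
    -- the functions are of class `C²` and quadratic in the momenta
    (∀ k < n, GeodEquiv.IsC2 (GeodEquiv.integralI g g' k) ∧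
      ∀ x : M, ∃ Q : QuadraticForm ℝ (TangentSpace 𝓘(ℝ, GeodEquiv.E n) x →L[ℝ] ℝ),
        ∀ p, GeodEquiv.integralI g g' k ⟨x, p⟩ = Q p) ∧
    -- they pairwise Poisson-commute
    (∀ k < n, ∀ l < n, GeodEquiv.PoissonCommute
      (GeodEquiv.integralI g g' k) (GeodEquiv.integralI g g' l)) ∧
    -- the last one is `-2H`
    (∀ k, k + 1 = n → ∀ z, GeodEquiv.integralI g g' k z = -2 * GeodEquiv.hamiltonian g z) ∧
    -- they are integrals of the geodesic flow of `g`
    (∀ k < n, GeodEquiv.PoissonCommute (GeodEquiv.integralI g g' k) (GeodEquiv.hamiltonian g) ∧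
      ∀ (J : Set ℝ) (z : ℝ → GeodEquiv.Cotangent n M), GeodEquiv.IsOpenInterval J →
        GeodEquiv.IsHamiltonianOrbit (GeodEquiv.hamiltonian g) z J →
        ∀ s ∈ J, ∀ t ∈ J, GeodEquiv.integralI g g' k (z s) = GeodEquiv.integralI g g' k (z t)) := by
  refine ⟨fun k hk => ⟨GeodEquiv.isC2_integralI g g' hk, GeodEquiv.exists_quadraticForm g g' k⟩,
    fun k hk l hl => GeodEquiv.poissonCommute_integralI h.1 hk hl,
    fun k hk z => GeodEquiv.integralI_last g g' hk z, fun k hk => ?_⟩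
  have hH := GeodEquiv.poissonCommute_hamiltonian h.1 hk
  exact ⟨hH, fun J z hJ hz s hs t ht =>
    GeodEquiv.eq_of_isHamiltonianOrbit (GeodEquiv.isC2_integralI g g' hk) hH hJ hz hs ht⟩
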